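/- **Conventions.** A globular set $A$ has sets $A_n$ of $n$-cells ($n\ge 0$) and source and target maps $s,t:A_{n+1}\to A_n$ with $ss=st$ and $ts=tt$; a morphism of globular sets commutes with sources and targets. Two $n$-cells with $n\ge 1$ are *parallel* if they have the same source and the same target; any two $0$-cells are parallel. Let $(-)^*$ be the free strict $\omega$-category monad on globular sets, with unit $\eta$ and multiplication $\mu$. The $n$-cells of $A^*$ are the $n$-pasting diagrams of cells of $A$. Let $\mathbf 1$ be the terminal globular set; the $n$-cells of $\mathbf 1^*$ are the shapes $\tau$ of $n$-pasting diagrams. The source and the target of such a $\tau$ (with $n\ge1$) coincide and are denoted $\partial\tau$. A *globular collection* is a globular set $G$ with a morphism $g:G\to \mathbf 1^*$. Collections form a monoidal category: the unit is $\eta:\mathbf 1\to\mathbf 1^*$, and $G\circ H=G\times_{\mathbf 1^*}H^*$, with structure map $G\circ H\to H^*\xrightarrow{h^*}\mathbf 1^{**}\xrightarrow{\mu}\mathbf 1^*$. A *globular operad* is a monoid in this monoidal category, and a morphism of globular operads is a morphism of monoids. Thus an $n$-cell $x$ of an operad $G$ has an operadic composite $x\circ(x_1,\dots,x_m)$ with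 every pasting diagram $(x_1,\dots,x_m)$ of shape $g(x)$ in $G$, and there is an identity $n$-cell $\mathrm{id}_n$ for every $n$. A *contraction function* on a collection $g:G\to\mathbf 1^*$ assigns to each triple $(x,x',\tau)$, where $x,x'$ are parallel $n$-cells of $G$ ($n\ge0$) and $\tau$ is an $(n+1)$-cell of $\mathbf 1^*$ with $g(x)=g(x')=\partial\tau$, an $(n+1)$-cell $\chi:x\to x'$ of $G$ with $g(\chi)=\tau$. A *globular operad with contraction* is a globular operad with a chosen contraction function on its underlying collection. Let $\mathbf{C\text{-}GOp}$ be the category of globular operads with contraction and of morphisms of globular operads that send the chosen contraction cell of $(x,x',\tau)$ to the chosen contraction cell of the image triple. **The operad $I$.** The globular operad $i:I\to\mathbf 1^*$ for weak unbiased $\omega$-categories is generated freely, dimension by dimension, as follows. It has a single $0$-cell, the identity $\mathrm{id}_0$. For $n>0$ its $n$-cells are the formal operadic composites (including the identity $\mathrm{id}_n$), subject only to the axioms of a globular operad, of generators $\chi:x\to x'$ with $i(\chi)=\tau$, one for each triple $(x,x',\tau)$ consisting of a parallel pair $(x,x')$ of $(n-1)$-cells of $I$ and an $n$-cell $\tau$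 of $\mathbf 1^*$ with $i(x)=i(x')=\partial\tau$. The *canonical contraction* on $I$ is the contraction function whose value at $(x,x',\tau)$ is the generator $\chi:x\to x'$ belonging to this triple. **Lemma.** Equipped with its canonical contraction, the globular operad $I$ is initial in the category $\mathbf{C\text{-}GOp}$. -/

import Mathlib

universe u v w

namespace Globular

/-- A globular set. -/
structure GlobularSet : Type (u + 1) where
  cell : ℕ → Type u
  src : ∀ {n : ℕ}, cell (n + 1) → cell n
  tgt : ∀ {n : ℕ}, cell (n + 1) → cell n
  src_src : ∀ {n : ℕ} (x : cell (n + 2)), src (src x) = src (tgt x)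
  tgt_src : ∀ {n : ℕ} (x : cell (n + 2)), tgt (src x) = tgt (tgt x)

/-- A morphism of globular sets (possibly living in different universes). -/
@[ext]
structure GlobularSet.Hom (A : GlobularSet.{u}) (B : GlobularSet.{v}) : Type (max u v) where
  map : ∀ n : ℕ, A.cell n → B.cell n
  map_src : ∀ {n : ℕ} (x : A.cell (n + 1)), map n (A.src x) = B.src (map (n + 1) x)
  map_tgt : ∀ {n : ℕ} (x : A.cell (n + 1)), map n (A.tgt x) = B.tgt (map (n + 1) x)

/-- The identity morphism of a globular set. -/
def GlobularSet.Hom.id (A : GlobularSet.{u}) : GlobularSet.Hom A A :=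
  ⟨fun _ x => x, fun _ => rfl, fun _ => rfl⟩

/-- The composite "first `f`, then `g`". -/
def GlobularSet.Hom.comp {A : GlobularSet.{u}} {B : GlobularSet.{v}} {C : GlobularSet.{w}}
    (f : GlobularSet.Hom A B) (g : GlobularSet.Hom B C) : GlobularSet.Hom A C :=
  ⟨fun n x => g.map n (f.map n x), fun x => by rw [f.map_src, g.map_src],
    fun x => by rw [f.map_tgt, g.map_tgt]⟩

/-- Two `n`-cells are parallel if they have the same source and target; all `0`-cells are
parallel. -/
def GlobularSet.Parallel (A : GlobularSet.{u}) : ∀ {n : ℕ}, A.cell n → A.cell n → Prop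
  | 0, _, _ => True
  | _ + 1, x, y => A.src x = A.src y ∧ A.tgt x = A.tgt y

/-- Shapes of `n`-pasting diagrams (pasting diagrams in the terminal globular set).  There is one
shape of dimension `0`; a shape of dimension `n + 1` is a finite list of shapes of dimension `n`:
a row of `0`-cells `a₀, …, aᵣ` with an `n`-dimensional diagram in the "hom" from `aᵢ₋₁` to `aᵢ`,
for each `i`. The empty list is the degenerate diagram on one `0`-cell. -/
inductive Pd : ℕ → Type
  | pt : Pd 0
  | nil {n : ℕ} : Pd (n + 1)
  | cons {n : ℕ} (σ : Pd n) (τ : Pd (n + 1)) : Pd (n + 1)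

/-- Auxiliary form of `Pd.bdry`, also defined (as the identity) in dimension `0`. -/
def Pd.bdryAux : ∀ {m : ℕ}, Pd m → Pd m.pred
  | 0, .pt => .pt
  | 1, .nil => .pt
  | _ + 2, .nil => .nil
  | 1, .cons _ _ => .pt
  | _ + 2, .cons σ τ => .cons σ.bdryAux τ.bdryAux

/-- The boundary (source and target) of a shape: remove all the cells of the top dimension. -/
def Pd.bdry {n : ℕ} (τ : Pd (n + 1)) : Pd n := τ.bdryAux

/-- The shape of the simple `n`-pasting diagram, a single `n`-cell. -/
def Pd.simple : ∀ n : ℕ, Pd n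
  | 0 => .pt
  | n + 1 => .cons (simple n) .nil

/-- `Pos τ k` is the set of `k`-cells of the pasting diagram `τ`.  For `τ = cons σ τ'` these are
the initial `0`-cell (`vert`), the `k + 1`-cells given by the `k`-cells of the diagram `σ` in the
first hom (`up`), and the cells of the remaining row `τ'` (`tail`). -/
inductive Pos : ∀ {n : ℕ}, Pd n → ℕ → Type
  | pt : Pos .pt 0
  | nil {n : ℕ} : Pos (.nil : Pd (n + 1)) 0
  | vert {n : ℕ} {σ : Pd n} {τ : Pd (n + 1)} : Pos (.cons σ τ) 0
  | up {n : ℕ} {σ : Pd n} {τ : Pd (n + 1)} {k : ℕ} (p : Pos σ k) : Pos (.cons σ τ) (k + 1)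
  | tail {n : ℕ} {σ : Pd n} {τ : Pd (n + 1)} {k : ℕ} (p : Pos τ k) : Pos (.cons σ τ) k

/-- The initial `0`-cell of a pasting diagram. -/
def Pos.first : ∀ {n : ℕ} (τ : Pd n), Pos τ 0
  | 0, .pt => .pt
  | _, .nil => .nil
  | _, .cons _ _ => .vert

/-- The final `0`-cell of a pasting diagram. -/
def Pos.last : ∀ {n : ℕ} (τ : Pd n), Pos τ 0
  | 0, .pt => .pt
  | _, .nil => .nil
  | _, .cons _ τ => .tail (last τ)

/-- Source of a cell of a pasting diagram. -/
def Pos.src : ∀ {n : ℕ} {τ : Pd n} {k : ℕ}, Pos τ (k + 1) → Pos τ k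
  | _, _, 0, .up _ => .vert
  | _, _, _ + 1, .up p => .up p.src
  | _, _, _, .tail p => .tail p.src

/-- Target of a cell of a pasting diagram. -/
def Pos.tgt : ∀ {n : ℕ} {τ : Pd n} {k : ℕ}, Pos τ (k + 1) → Pos τ k
  | _, .cons _ τ, 0, .up _ => .tail (Pos.first τ)
  | _, _, _ + 1, .up p => .up p.tgt
  | _, _, _, .tail p => .tail p.tgt

theorem Pos.src_tail {n k : ℕ} {σ : Pd n} {τ : Pd (n + 1)} (p : Pos τ (k + 1)) :
    (Pos.tail p : Pos (.cons σ τ) (k + 1)).src = .tail p.src := by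
  cases k <;> rfl

theorem Pos.tgt_tail {n k : ℕ} {σ : Pd n} {τ : Pd (n + 1)} (p : Pos τ (k + 1)) :
    (Pos.tail p : Pos (.cons σ τ) (k + 1)).tgt = .tail p.tgt := by
  cases k <;> rfl

theorem Pos.src_src {n : ℕ} {τ : Pd n} {k : ℕ} (p : Pos τ (k + 2)) : p.src.src = p.tgt.src := by
  induction τ generalizing k with
  | pt => cases p
  | nil => cases p
  | cons σ τ ih1 ih2 =>
    cases p with
    | up p => cases k with
      | zero => rfl
      | succ k => exact congrArg Pos.up (ih1 p)
    | tail p => simp only [src_tail, tgt_tail, ih2]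

theorem Pos.tgt_src {n : ℕ} {τ : Pd n} {k : ℕ} (p : Pos τ (k + 2)) : p.src.tgt = p.tgt.tgt := by
  induction τ generalizing k with
  | pt => cases p
  | nil => cases p
  | cons σ τ ih1 ih2 =>
    cases p with
    | up p => cases k with
      | zero => rfl
      | succ k => exact congrArg Pos.up (ih1 p)
    | tail p => simp only [src_tail, tgt_tail, ih2]

/-- The globular set of cells of a pasting diagram. -/
def Pd.pos {n : ℕ} (τ : Pd n) : GlobularSet.{0} where
  cell := Pos τ
  src := Pos.src
  tgt := Pos.tgt
  src_src := Pos.src_src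
  tgt_src := Pos.tgt_src

/-- The map from the one-point diagram that picks out a given `0`-cell. -/
def Pos.ofPt {n : ℕ} {τ : Pd n} (q : Pos τ 0) : ∀ {k : ℕ}, Pos .pt k → Pos τ k
  | _, .pt => q

/-- The map from a degenerate one-point diagram that picks out a given `0`-cell. -/
def Pos.ofNil {n n' : ℕ} {τ : Pd n} (q : Pos τ 0) :
    ∀ {k : ℕ}, Pos (.nil : Pd (n' + 1)) k → Pos τ k
  | _, .nil => q

/-- Maps of the first entry and of the remaining row of a diagram give a map of the diagram. -/
def Pos.mapCons {n n' : ℕ} {σ : Pd n} {τ : Pd (n + 1)} {σ' : Pd n'} {τ' : Pd (n' + 1)}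
    (f : ∀ k : ℕ, Pos σ k → Pos σ' k) (g : ∀ k : ℕ, Pos τ k → Pos τ' k) :
    ∀ {k : ℕ}, Pos (.cons σ τ) k → Pos (.cons σ' τ') k
  | _, .vert => .vert
  | _, .up p => .up (f _ p)
  | _, .tail p => .tail (g _ p)

/-- Auxiliary form of `Pos.inclS`. -/
def Pos.inclSAux : ∀ {m : ℕ} (τ : Pd m) (k : ℕ), Pos τ.bdryAux k → Pos τ k
  | 0, .pt, _, p => p
  | 1, .nil, _, p => ofPt .nil p
  | 1, .cons _ _, _, p => ofPt .vert p
  | _ + 2, .nil, _, p => ofNil .nil p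
  | _ + 2, .cons σ τ, _, p => mapCons (inclSAux σ) (inclSAux τ) p

/-- Auxiliary form of `Pos.inclT`. -/
def Pos.inclTAux : ∀ {m : ℕ} (τ : Pd m) (k : ℕ), Pos τ.bdryAux k → Pos τ k
  | 0, .pt, _, p => p
  | 1, .nil, _, p => ofPt .nil p
  | 1, .cons _ τ, _, p => ofPt (.tail (.last τ)) p
  | _ + 2, .nil, _, p => ofNil .nil p
  | _ + 2, .cons σ τ, _, p => mapCons (inclTAux σ) (inclTAux τ) p

/-- The inclusion of the boundary of a pasting diagram as its source. -/
def Pos.inclS {n : ℕ} (τ : Pd (n + 1)) {k : ℕ} (p : Pos τ.bdry k) : Pos τ k := inclSAux τ k p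

/-- The inclusion of the boundary of a pasting diagram as its target. -/
def Pos.inclT {n : ℕ} (τ : Pd (n + 1)) {k : ℕ} (p : Pos τ.bdry k) : Pos τ k := inclTAux τ k p

theorem Pos.inclS_first {n : ℕ} (τ : Pd (n + 1)) : inclS τ (first τ.bdry) = first τ := by
  cases n <;> cases τ <;> rfl

theorem Pos.inclT_first {n : ℕ} (τ : Pd (n + 2)) : inclT τ (first τ.bdry) = first τ := by
  cases τ <;> rfl

theorem Pos.inclS_last : ∀ {n : ℕ} (τ : Pd (n + 2)), inclS τ (last τ.bdry) = last τ
  | _, .nil => rfl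
  | _, .cons _ τ => congrArg Pos.tail (inclS_last τ)

theorem Pos.inclT_last : ∀ {n : ℕ} (τ : Pd (n + 1)), inclT τ (last τ.bdry) = last τ
  | 0, .nil => rfl
  | 0, .cons _ _ => rfl
  | _ + 1, .nil => rfl
  | _ + 1, .cons _ τ => congrArg Pos.tail (inclT_last τ)

theorem Pos.mapCons_src {n n' : ℕ} {σ : Pd n} {τ : Pd (n + 1)} {σ' : Pd n'} {τ' : Pd (n' + 1)}
    (f : ∀ k : ℕ, Pos σ k → Pos σ' k) (g : ∀ k : ℕ, Pos τ k → Pos τ' k)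
    (hf : ∀ k (p : Pos σ (k + 1)), f k p.src = (f _ p).src)
    (hg : ∀ k (p : Pos τ (k + 1)), g k p.src = (g _ p).src)
    {k : ℕ} (p : Pos (.cons σ τ) (k + 1)) :
    mapCons f g p.src = (mapCons f g p).src := by
  cases p with
  | up p => cases k with
    | zero => rfl
    | succ k => exact congrArg Pos.up (hf k p)
  | tail p => cases k <;> exact congrArg Pos.tail (hg _ p)

theorem Pos.mapCons_tgt {n n' : ℕ} {σ : Pd n} {τ : Pd (n + 1)} {σ' : Pd n'} {τ' : Pd (n' + 1)}
    (f : ∀ k : ℕ, Pos σ k → Pos σ' k) (g : ∀ k : ℕ, Pos τ k → Pos τ' k)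
    (h : g 0 (first τ) = first τ')
    (hf : ∀ k (p : Pos σ (k + 1)), f k p.tgt = (f _ p).tgt)
    (hg : ∀ k (p : Pos τ (k + 1)), g k p.tgt = (g _ p).tgt)
    {k : ℕ} (p : Pos (.cons σ τ) (k + 1)) :
    mapCons f g p.tgt = (mapCons f g p).tgt := by
  cases p with
  | up p => cases k with
    | zero => exact congrArg Pos.tail h
    | succ k => exact congrArg Pos.up (hf k p)
  | tail p => cases k <;> exact congrArg Pos.tail (hg _ p)

theorem Pos.inclS_src : ∀ {n : ℕ} (τ : Pd (n + 1)) (k : ℕ) (p : Pos τ.bdry (k + 1)),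
    inclS τ p.src = (inclS τ p).src
  | 0, .nil, _, p => nomatch (show Pos .pt _ from p)
  | 0, .cons _ _, _, p => nomatch (show Pos .pt _ from p)
  | _ + 1, .nil, _, p => nomatch (show Pos .nil _ from p)
  | _ + 1, .cons σ τ, _, p => mapCons_src _ _ (inclS_src σ) (inclS_src τ) p

theorem Pos.inclS_tgt : ∀ {n : ℕ} (τ : Pd (n + 1)) (k : ℕ) (p : Pos τ.bdry (k + 1)),
    inclS τ p.tgt = (inclS τ p).tgt
  | 0, .nil, _, p => nomatch (show Pos .pt _ from p)
  | 0, .cons _ _, _, p => nomatch (show Pos .pt _ from p)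
  | _ + 1, .nil, _, p => nomatch (show Pos .nil _ from p)
  | _ + 1, .cons σ τ, _, p =>
    mapCons_tgt _ _ (inclS_first τ) (inclS_tgt σ) (inclS_tgt τ) p

theorem Pos.inclT_src : ∀ {n : ℕ} (τ : Pd (n + 1)) (k : ℕ) (p : Pos τ.bdry (k + 1)),
    inclT τ p.src = (inclT τ p).src
  | 0, .nil, _, p => nomatch (show Pos .pt _ from p)
  | 0, .cons _ _, _, p => nomatch (show Pos .pt _ from p)
  | _ + 1, .nil, _, p => nomatch (show Pos .nil _ from p)
  | _ + 1, .cons σ τ, _, p => mapCons_src _ _ (inclT_src σ) (inclT_src τ) p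

theorem Pos.inclT_tgt : ∀ {n : ℕ} (τ : Pd (n + 1)) (k : ℕ) (p : Pos τ.bdry (k + 1)),
    inclT τ p.tgt = (inclT τ p).tgt
  | 0, .nil, _, p => nomatch (show Pos .pt _ from p)
  | 0, .cons _ _, _, p => nomatch (show Pos .pt _ from p)
  | _ + 1, .nil, _, p => nomatch (show Pos .nil _ from p)
  | _ + 1, .cons σ τ, _, p =>
    mapCons_tgt _ _ (inclT_first τ) (inclT_tgt σ) (inclT_tgt τ) p

theorem Pos.mapCons_comp_congr {n₁ n₂ n₃ n₄ : ℕ} {σ₁ : Pd n₁} {τ₁ : Pd (n₁ + 1)}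
    {σ₂ : Pd n₂} {τ₂ : Pd (n₂ + 1)} {σ₃ : Pd n₃} {τ₃ : Pd (n₃ + 1)}
    {σ₄ : Pd n₄} {τ₄ : Pd (n₄ + 1)}
    {f : ∀ k : ℕ, Pos σ₁ k → Pos σ₂ k} {g : ∀ k : ℕ, Pos τ₁ k → Pos τ₂ k}
    {f' : ∀ k : ℕ, Pos σ₂ k → Pos σ₃ k} {g' : ∀ k : ℕ, Pos τ₂ k → Pos τ₃ k}
    {a : ∀ k : ℕ, Pos σ₁ k → Pos σ₄ k} {b : ∀ k : ℕ, Pos τ₁ k → Pos τ₄ k}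
    {a' : ∀ k : ℕ, Pos σ₄ k → Pos σ₃ k} {b' : ∀ k : ℕ, Pos τ₄ k → Pos τ₃ k}
    (h₁ : ∀ k p, f' k (f k p) = a' k (a k p)) (h₂ : ∀ k p, g' k (g k p) = b' k (b k p))
    {k : ℕ} (p : Pos (.cons σ₁ τ₁) k) :
    mapCons f' g' (mapCons f g p) = mapCons a' b' (mapCons a b p) := by
  cases p with
  | vert => rfl
  | up p => exact congrArg Pos.up (h₁ _ p)
  | tail p => exact congrArg Pos.tail (h₂ _ p)

theorem Pos.ofPt_eq {n : ℕ} {τ : Pd n} {x y : ∀ k : ℕ, Pos .pt k → Pos τ k}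
    (h : x 0 .pt = y 0 .pt) {k : ℕ} (p : Pos .pt k) : x k p = y k p := by
  cases p; exact h

theorem Pos.inclS_inclS : ∀ {n : ℕ} (τ : Pd (n + 2)) (k : ℕ) (p : Pos τ.bdry.bdry k),
    inclS τ (inclS τ.bdry p) = inclT τ (inclS τ.bdry p)
  | 0, .nil, _, p => ofPt_eq (x := fun k p => inclS .nil (inclS (n := 0) .nil p))
      (y := fun k p => inclT .nil (inclS (n := 0) .nil p)) rfl p
  | 0, .cons σ τ, _, p => ofPt_eq (x := fun k p => inclS (.cons σ τ) (inclS (n := 0) _ p))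
      (y := fun k p => inclT (.cons σ τ) (inclS (n := 0) _ p)) rfl p
  | _ + 1, .nil, _, _ => rfl
  | _ + 1, .cons σ τ, _, p => mapCons_comp_congr (inclS_inclS σ) (inclS_inclS τ) p

theorem Pos.inclS_inclT : ∀ {n : ℕ} (τ : Pd (n + 2)) (k : ℕ) (p : Pos τ.bdry.bdry k),
    inclS τ (inclT τ.bdry p) = inclT τ (inclT τ.bdry p)
  | 0, .nil, _, p => ofPt_eq (x := fun k p => inclS .nil (inclT (n := 0) .nil p))
      (y := fun k p => inclT .nil (inclT (n := 0) .nil p)) rfl p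
  | 0, .cons σ τ, _, p => ofPt_eq (x := fun k p => inclS (.cons σ τ) (inclT (n := 0) _ p))
      (y := fun k p => inclT (.cons σ τ) (inclT (n := 0) _ p)) 
        (congrArg Pos.tail ((inclS_last τ).trans (inclT_last τ).symm)) p
  | _ + 1, .nil, _, _ => rfl
  | _ + 1, .cons σ τ, _, p => mapCons_comp_congr (inclS_inclT σ) (inclS_inclT τ) p

/-- `Sub τ`: the ways of assigning to every cell of `τ` a shape of the same dimension, compatibly
with boundaries.  An assignment for `cons σ τ` is a list of assignments for `σ` (`cnil`, `ccons`)
together with an assignment for `τ`. -/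
inductive Sub : ∀ {n : ℕ}, Pd n → Type
  | pt : Sub .pt
  | nil {n : ℕ} : Sub (.nil : Pd (n + 1))
  | cnil {n : ℕ} {σ : Pd n} {τ : Pd (n + 1)} (R : Sub τ) : Sub (.cons σ τ)
  | ccons {n : ℕ} {σ : Pd n} {τ : Pd (n + 1)} (S : Sub σ) (R : Sub (.cons σ τ)) : Sub (.cons σ τ)

/-- The shape assigned to a cell. -/
def Sub.at : ∀ {n : ℕ} {τ : Pd n}, Sub τ → ∀ {k : ℕ}, Pos τ k → Pd k
  | _, _, .pt, _, .pt => .pt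
  | _, _, .nil, _, .nil => .pt
  | _, _, .cnil _, _, .vert => .pt
  | _, _, .cnil _, _, .up _ => .nil
  | _, _, .cnil R, _, .tail p => R.at p
  | _, _, .ccons _ _, _, .vert => .pt
  | _, _, .ccons S R, _, .up p => .cons (S.at p) (R.at (.up p))
  | _, _, .ccons _ R, _, .tail p => R.at (.tail p)

/-- The shape obtained from `τ` by replacing every cell by its assigned shape. -/
def Sub.total : ∀ {n : ℕ} {τ : Pd n}, Sub τ → Pd n
  | _, _, .pt => .pt
  | _, _, .nil => .nil
  | _, _, .cnil R => R.total
  | _, _, .ccons S R => .cons S.total R.total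

/-- The inclusion of the shape assigned to a cell `p` in the total shape. -/
def Sub.emb : ∀ {n : ℕ} {τ : Pd n} (S : Sub τ) {k : ℕ} (p : Pos τ k) {m : ℕ},
    Pos (S.at p) m → Pos S.total m
  | _, _, .pt, _, .pt, _, q => q
  | _, _, .nil, _, .nil, _, q => .ofPt .nil q
  | _, _, .cnil R, _, .vert, _, q => .ofPt (.first R.total) q
  | _, _, .cnil R, _, .up _, _, q => .ofNil (.first R.total) q
  | _, _, .cnil R, _, .tail p, _, q => R.emb p q
  | _, _, .ccons _ _, _, .vert, _, q => .ofPt .vert q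
  | _, _, .ccons S R, _, .up p, _, q => .mapCons (fun _ => S.emb p) (fun _ => R.emb (.up p)) q
  | _, _, .ccons _ R, _, .tail p, _, q => .tail (R.emb (.tail p) q)

theorem Pd.eq_pt (σ : Pd 0) : σ = .pt := by cases σ; rfl

theorem Pd.zero_eq (σ τ : Pd 0) : σ = τ := by rw [σ.eq_pt, τ.eq_pt]

theorem Sub.bdry_at_src {n : ℕ} {τ : Pd n} (S : Sub τ) {k : ℕ} (p : Pos τ (k + 1)) :
    (S.at p).bdry = S.at p.src := by
  induction S generalizing k with
  | pt => cases p
  | nil => cases p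
  | cnil R ih => cases p with
    | up p => cases k with
      | zero => rfl
      | succ k => rfl
    | tail p => cases k <;> exact ih p
  | ccons S R ih1 ih2 => cases p with
    | up p => cases k with
      | zero => rfl
      | succ k => exact congrArg₂ Pd.cons (ih1 p) (ih2 (.up p))
    | tail p => have := ih2 (.tail p); cases k <;> exact this

theorem Sub.bdry_at_tgt {n : ℕ} {τ : Pd n} (S : Sub τ) {k : ℕ} (p : Pos τ (k + 1)) :
    (S.at p).bdry = S.at p.tgt := by
  induction S generalizing k with
  | pt => cases p
  | nil => cases p
  | cnil R ih => cases p with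
    | up p => cases k with
      | zero => exact Pd.zero_eq _ _
      | succ k => rfl
    | tail p => cases k <;> exact ih p
  | ccons S R ih1 ih2 => cases p with
    | up p => cases k with
      | zero => exact Pd.zero_eq _ _
      | succ k => exact congrArg₂ Pd.cons (ih1 p) (ih2 (.up p))
    | tail p => have := ih2 (.tail p); cases k <;> exact this

theorem Sub.emb_up_first {n : ℕ} {σ : Pd n} {τ : Pd (n + 1)} (S : Sub (.cons σ τ)) {k : ℕ}
    (p : Pos σ k) : S.emb (.up p) (.first _) = .first _ := by
  cases S <;> rfl

theorem Sub.emb_src {n : ℕ} {τ : Pd n} (S : Sub τ) {k : ℕ} (p : Pos τ k) {m : ℕ}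
    (q : Pos (S.at p) (m + 1)) : S.emb p q.src = (S.emb p q).src := by
  induction S generalizing k m with
  | pt => cases p; cases q
  | nil => cases p; cases q
  | cnil R ih => cases p with
    | vert => cases q
    | up p => cases q
    | tail p => exact ih p q
  | ccons S R ih1 ih2 => cases p with
    | vert => cases q
    | up p => exact Pos.mapCons_src _ _ (fun _ => ih1 p) (fun _ => ih2 (.up p)) q
    | tail p => have := ih2 (.tail p) q; cases m <;> exact congrArg Pos.tail this

theorem Sub.emb_tgt {n : ℕ} {τ : Pd n} (S : Sub τ) {k : ℕ} (p : Pos τ k) {m : ℕ}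
    (q : Pos (S.at p) (m + 1)) : S.emb p q.tgt = (S.emb p q).tgt := by
  induction S generalizing k m with
  | pt => cases p; cases q
  | nil => cases p; cases q
  | cnil R ih => cases p with
    | vert => cases q
    | up p => cases q
    | tail p => exact ih p q
  | ccons S R ih1 ih2 => cases p with
    | vert => cases q
    | up p =>
      exact Pos.mapCons_tgt _ _ (R.emb_up_first p) (fun _ => ih1 p) (fun _ => ih2 (.up p)) q
    | tail p => have := ih2 (.tail p) q; cases m <;> exact congrArg Pos.tail this

/-- The restriction of an assignment to the boundary of `τ`. -/
def Sub.bdryAux : ∀ {m : ℕ} {τ : Pd m}, Sub τ → Sub τ.bdryAux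
  | 0, .pt, .pt => .pt
  | 1, .nil, _ => .pt
  | 1, .cons _ _, _ => .pt
  | _ + 2, _, .nil => .nil
  | _ + 2, _, .cnil R => .cnil R.bdryAux
  | _ + 2, _, .ccons S R => .ccons S.bdryAux R.bdryAux

/-- The restriction of an assignment to the boundary. -/
def Sub.bdry {n : ℕ} {τ : Pd (n + 1)} (S : Sub τ) : Sub τ.bdry := S.bdryAux

/-- Transport of cells along an equality of shapes. -/
def Pos.cast {n : ℕ} {τ τ' : Pd n} (h : τ = τ') {k : ℕ} (p : Pos τ k) : Pos τ' k := h ▸ p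

theorem Pos.cast_rfl {n : ℕ} {τ : Pd n} (h : τ = τ) {k : ℕ} (p : Pos τ k) : p.cast h = p := rfl

theorem Pos.cast_cast {n : ℕ} {τ τ' τ'' : Pd n} (h : τ = τ') (h' : τ' = τ'') {k : ℕ}
    (p : Pos τ k) : (p.cast h).cast h' = p.cast (h.trans h') := by
  subst h; subst h'; rfl

theorem Pos.cast_src {n : ℕ} {τ τ' : Pd n} (h : τ = τ') {k : ℕ} (p : Pos τ (k + 1)) :
    (p.cast h).src = p.src.cast h := by
  subst h; rfl

theorem Pos.cast_tgt {n : ℕ} {τ τ' : Pd n} (h : τ = τ') {k : ℕ} (p : Pos τ (k + 1)) :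
    (p.cast h).tgt = p.tgt.cast h := by
  subst h; rfl

theorem Pos.cast_first {n : ℕ} {τ τ' : Pd n} (h : τ = τ') : (first τ).cast h = first τ' := by
  subst h; rfl

theorem Pos.cast_vert {n : ℕ} {σ σ' : Pd n} {τ τ' : Pd (n + 1)}
    (h : Pd.cons σ τ = Pd.cons σ' τ') : (.vert : Pos (.cons σ τ) 0).cast h = .vert := by
  cases h; rfl

theorem Pos.cast_up {n : ℕ} {σ σ' : Pd n} {τ τ' : Pd (n + 1)} (hσ : σ = σ')
    (h : Pd.cons σ τ = Pd.cons σ' τ') {k : ℕ} (p : Pos σ k) :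
    (.up p : Pos (.cons σ τ) (k + 1)).cast h = .up (p.cast hσ) := by
  cases h; rfl

theorem Pos.cast_tail {n : ℕ} {σ σ' : Pd n} {τ τ' : Pd (n + 1)} (hτ : τ = τ')
    (h : Pd.cons σ τ = Pd.cons σ' τ') {k : ℕ} (p : Pos τ k) :
    (.tail p : Pos (.cons σ τ) k).cast h = .tail (p.cast hτ) := by
  cases h; rfl

theorem Pos.dim_zero {τ : Pd 0} {k : ℕ} (p : Pos τ k) : k = 0 := by
  cases τ; cases p; rfl

theorem Pos.zero_eq {τ : Pd 0} (p q : Pos τ 0) : p = q := by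
  cases τ; cases p; cases q; rfl

theorem Sub.emb_first {n : ℕ} {τ : Pd n} (S : Sub τ) (q : Pos (S.at (.first τ)) 0) :
    S.emb (.first τ) q = .first _ := by
  cases S <;> cases q <;> rfl

theorem Sub.emb_first' {n : ℕ} {τ : Pd n} (S : Sub τ) {p : Pos τ 0} (hp : p = .first τ)
    (q : Pos (S.at p) 0) : S.emb p q = .first _ := by
  subst hp; exact S.emb_first q

theorem Sub.emb_up_last : ∀ {n : ℕ} {σ : Pd n} {τ : Pd (n + 1)} (S : Sub (.cons σ τ))
    (p : Pos σ 0) (q : Pos (S.at (.tail (.first τ))) 0),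
    S.emb (.up p) (.last _) = S.emb (.tail (.first τ)) q
  | _, _, _, .cnil R, _, q => (R.emb_first q).symm
  | _, _, _, .ccons _ R, p, q => congrArg Pos.tail (R.emb_up_last p q)

theorem Sub.emb_src_eq {n : ℕ} {τ : Pd n} (S : Sub τ) {k : ℕ} (p : Pos τ (k + 1)) {m : ℕ}
    (q : Pos (S.at p).bdry m) :
    S.emb p.src (q.cast (S.bdry_at_src p)) = S.emb p (.inclS _ q) := by
  induction S generalizing k m with
  | pt => cases p
  | nil => cases p
  | cnil R ih => cases p with
    | up p => cases k with
      | zero => change Pos .pt m at q; cases q; rfl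
      | succ k => change Pos .nil m at q; cases q; rfl
    | tail p => have := ih p q; cases k <;> exact this
  | ccons S R ih1 ih2 => cases p with
    | up p => cases k with
      | zero => change Pos .pt m at q; cases q; rfl
      | succ k =>
        change Pos (.cons _ _) m at q
        cases q with
        | vert => erw [Pos.cast_vert]; rfl
        | up q =>
          erw [Pos.cast_up (S.bdry_at_src p)]
          exact congrArg Pos.up (ih1 p q)
        | tail q =>
          erw [Pos.cast_tail (R.bdry_at_src (.up p))]
          exact congrArg Pos.tail (ih2 (.up p) q)
    | tail p => have := ih2 (.tail p) q; cases k <;> exact congrArg Pos.tail this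

theorem Sub.emb_tgt_eq {n : ℕ} {τ : Pd n} (S : Sub τ) {k : ℕ} (p : Pos τ (k + 1)) {m : ℕ}
    (q : Pos (S.at p).bdry m) :
    S.emb p.tgt (q.cast (S.bdry_at_tgt p)) = S.emb p (.inclT _ q) := by
  induction S generalizing k m with
  | pt => cases p
  | nil => cases p
  | cnil R ih => cases p with
    | up p => cases k with
      | zero => change Pos .pt m at q; cases q; exact R.emb_first _
      | succ k => change Pos .nil m at q; cases q; rfl
    | tail p => have := ih p q; cases k <;> exact this
  | ccons S R ih1 ih2 => cases p with
    | up p => cases k with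
      | zero =>
        change Pos .pt m at q; cases q
        exact congrArg Pos.tail (R.emb_up_last p _).symm
      | succ k =>
        change Pos (.cons _ _) m at q
        cases q with
        | vert => erw [Pos.cast_vert]; rfl
        | up q =>
          erw [Pos.cast_up (S.bdry_at_tgt p)]
          exact congrArg Pos.up (ih1 p q)
        | tail q =>
          erw [Pos.cast_tail (R.bdry_at_tgt (.up p))]
          exact congrArg Pos.tail (ih2 (.up p) q)
    | tail p => have := ih2 (.tail p) q; cases k <;> exact congrArg Pos.tail this

theorem Sub.total_bdry : ∀ {n : ℕ} {τ : Pd (n + 1)} (S : Sub τ), S.bdry.total = S.total.bdry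
  | 0, _, _ => Pd.zero_eq _ _
  | _ + 1, _, .nil => rfl
  | _ + 1, _, .cnil R => R.total_bdry
  | _ + 1, _, .ccons S R => congrArg₂ Pd.cons S.total_bdry R.total_bdry

theorem Sub.at_bdry_inclS : ∀ {n : ℕ} {τ : Pd (n + 1)} (S : Sub τ) (k : ℕ) (p : Pos τ.bdry k),
    S.bdry.at p = S.at (.inclS τ p)
  | 0, .nil, S, _, p => by change Pos .pt _ at p; cases p; exact Pd.zero_eq _ _
  | 0, .cons _ _, S, _, p => by change Pos .pt _ at p; cases p; exact Pd.zero_eq _ _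
  | _ + 1, _, .nil, _, p => by change Pos .nil _ at p; cases p; rfl
  | _ + 1, _, .cnil R, _, p => by
    change Pos (.cons _ _) _ at p
    cases p with
    | vert => rfl
    | up p => rfl
    | tail p => exact R.at_bdry_inclS _ p
  | _ + 1, _, .ccons S R, _, p => by
    change Pos (.cons _ _) _ at p
    cases p with
    | vert => rfl
    | up p => exact congrArg₂ Pd.cons (S.at_bdry_inclS _ p) (R.at_bdry_inclS _ (.up p))
    | tail p => exact R.at_bdry_inclS _ (.tail p)

theorem Sub.at_bdry_inclT : ∀ {n : ℕ} {τ : Pd (n + 1)} (S : Sub τ) (k : ℕ) (p : Pos τ.bdry k),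
    S.bdry.at p = S.at (.inclT τ p)
  | 0, .nil, S, _, p => by change Pos .pt _ at p; cases p; exact Pd.zero_eq _ _
  | 0, .cons _ _, S, _, p => by change Pos .pt _ at p; cases p; exact Pd.zero_eq _ _
  | _ + 1, _, .nil, _, p => by change Pos .nil _ at p; cases p; rfl
  | _ + 1, _, .cnil R, _, p => by
    change Pos (.cons _ _) _ at p
    cases p with
    | vert => rfl
    | up p => rfl
    | tail p => exact R.at_bdry_inclT _ p
  | _ + 1, _, .ccons S R, _, p => by
    change Pos (.cons _ _) _ at p
    cases p with
    | vert => rfl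
    | up p => exact congrArg₂ Pd.cons (S.at_bdry_inclT _ p) (R.at_bdry_inclT _ (.up p))
    | tail p => exact R.at_bdry_inclT _ (.tail p)

theorem Sub.emb_last {n : ℕ} {τ : Pd n} (S : Sub τ) (q : Pos (S.at (.last τ)) 0) :
    S.emb (.last τ) q = .last _ := by
  induction S with
  | pt => cases q; rfl
  | nil => cases q; rfl
  | cnil R ih => exact ih q
  | ccons S R ih1 ih2 => exact congrArg Pos.tail (ih2 q)

theorem Sub.emb_last' {n : ℕ} {τ : Pd n} (S : Sub τ) {p : Pos τ 0} (hp : p = .last τ)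
    (q : Pos (S.at p) 0) : S.emb p q = .last _ := by
  subst hp; exact S.emb_last q

theorem Sub.emb_bdry_inclS : ∀ {n : ℕ} {τ : Pd (n + 1)} (S : Sub τ) (k : ℕ) (p : Pos τ.bdry k)
    {m : ℕ} (q : Pos (S.bdry.at p) m),
    Pos.inclS S.total ((S.bdry.emb p q).cast S.total_bdry) =
      S.emb (.inclS τ p) (q.cast (S.at_bdry_inclS k p))
  | 0, τ, S, _, p, m, q => by
    obtain rfl := Pos.dim_zero p
    obtain rfl := Pos.dim_zero q
    rw [Pos.zero_eq ((S.bdry.emb p q).cast S.total_bdry) (.first _), Pos.inclS_first]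
    have : Pos.inclS τ p = .first τ := by rw [Pos.zero_eq p (.first _), Pos.inclS_first]
    exact (S.emb_first' this _).symm
  | _ + 1, _, .nil, _, p, m, q => by
    change Pos .nil _ at p; cases p; change Pos .pt _ at q; cases q; rfl
  | _ + 1, _, .cnil R, _, p, m, q => by
    change Pos (.cons _ _) _ at p
    cases p with
    | vert => change Pos .pt _ at q; cases q; erw [Pos.cast_first]; exact Pos.inclS_first _
    | up p => change Pos .nil _ at q; cases q; erw [Pos.cast_first]; exact Pos.inclS_first _
    | tail p => exact R.emb_bdry_inclS _ p q
  | _ + 1, _, .ccons S R, _, p, m, q => by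
    change Pos (.cons _ _) _ at p
    cases p with
    | vert => change Pos .pt _ at q; cases q; erw [Pos.cast_vert]; rfl
    | up p =>
      change Pos (.cons _ _) _ at q
      cases q with
      | vert => erw [Pos.cast_vert, Pos.cast_vert]; rfl
      | up q =>
        erw [Pos.cast_up S.total_bdry, Pos.cast_up (S.at_bdry_inclS _ p)]
        exact congrArg Pos.up (S.emb_bdry_inclS _ p q)
      | tail q =>
        erw [Pos.cast_tail R.total_bdry, Pos.cast_tail (R.at_bdry_inclS _ (.up p))]
        exact congrArg Pos.tail (R.emb_bdry_inclS _ (.up p) q)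
    | tail p =>
      erw [Pos.cast_tail R.total_bdry]
      exact congrArg Pos.tail (R.emb_bdry_inclS _ (.tail p) q)

theorem Sub.emb_bdry_inclT : ∀ {n : ℕ} {τ : Pd (n + 1)} (S : Sub τ) (k : ℕ) (p : Pos τ.bdry k)
    {m : ℕ} (q : Pos (S.bdry.at p) m),
    Pos.inclT S.total ((S.bdry.emb p q).cast S.total_bdry) =
      S.emb (.inclT τ p) (q.cast (S.at_bdry_inclT k p))
  | 0, τ, S, _, p, m, q => by
    obtain rfl := Pos.dim_zero p
    obtain rfl := Pos.dim_zero q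
    rw [Pos.zero_eq ((S.bdry.emb p q).cast S.total_bdry) (.last _), Pos.inclT_last]
    have : Pos.inclT τ p = .last τ := by rw [Pos.zero_eq p (.last _), Pos.inclT_last]
    exact (S.emb_last' this _).symm
  | _ + 1, _, .nil, _, p, m, q => by
    change Pos .nil _ at p; cases p; change Pos .pt _ at q; cases q; rfl
  | _ + 1, _, .cnil R, _, p, m, q => by
    change Pos (.cons _ _) _ at p
    cases p with
    | vert =>
      change Pos .pt _ at q; cases q; erw [Pos.cast_first]; exact Pos.inclT_first R.total
    | up p =>
      change Pos .nil _ at q; cases q; erw [Pos.cast_first]; exact Pos.inclT_first R.total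
    | tail p => exact R.emb_bdry_inclT _ p q
  | _ + 1, _, .ccons S R, _, p, m, q => by
    change Pos (.cons _ _) _ at p
    cases p with
    | vert => change Pos .pt _ at q; cases q; erw [Pos.cast_vert]; rfl
    | up p =>
      change Pos (.cons _ _) _ at q
      cases q with
      | vert => erw [Pos.cast_vert, Pos.cast_vert]; rfl
      | up q =>
        erw [Pos.cast_up S.total_bdry, Pos.cast_up (S.at_bdry_inclT _ p)]
        exact congrArg Pos.up (S.emb_bdry_inclT _ p q)
      | tail q =>
        erw [Pos.cast_tail R.total_bdry, Pos.cast_tail (R.at_bdry_inclT _ (.up p))]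
        exact congrArg Pos.tail (R.emb_bdry_inclT _ (.up p) q)
    | tail p =>
      erw [Pos.cast_tail R.total_bdry]
      exact congrArg Pos.tail (R.emb_bdry_inclT _ (.tail p) q)

/-- The type of `Sub.foldAux`. -/
def Sub.FoldTy (X : Type) : ∀ {n : ℕ}, Pd n → Type
  | _, .pt => Unit
  | _, .nil => Unit
  | _, .cons σ τ => (Sub τ → X) → (Sub σ → X → X) → X

/-- Auxiliary form of `Sub.fold`. -/
def Sub.foldAux {X : Type} : ∀ {n : ℕ} {π : Pd n}, Sub π → Sub.FoldTy X π
  | _, _, .pt => ()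
  | _, _, .nil => ()
  | _, _, .cnil K => fun g _ => g K
  | _, _, .ccons L K => fun g c => c L (foldAux K g c)

/-- Recursion along the list of assignments for `σ` in an assignment for `cons σ τ`. -/
def Sub.fold {X : Type} {n : ℕ} {σ : Pd n} {τ : Pd (n + 1)} (g : Sub τ → X) (c : Sub σ → X → X)
    (K : Sub (.cons σ τ)) : X := foldAux K g c

/-- Auxiliary construction for `Sub.bind`. -/
def Sub.bindCons {n : ℕ} {σ ρ : Pd n} {τ υ : Pd (n + 1)} (f : Sub σ → Sub ρ)
    (g : Sub τ → Sub (.cons ρ υ)) : Sub (.cons σ τ) → Sub (.cons ρ υ) :=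
  fold g fun L K => .ccons (f L) K

/-- Auxiliary construction for `Sub.res`. -/
def Sub.resUp {n m : ℕ} {σ : Pd n} {ρ : Pd m} {τ : Pd (n + 1)} {υ : Pd (m + 1)}
    (f : Sub σ → Sub ρ) (g : Sub τ → Sub υ) : Sub (.cons σ τ) → Sub (.cons ρ υ) :=
  fold (fun K => .cnil (g K)) fun L K => .ccons (f L) K

/-- Auxiliary construction for `Sub.res`. -/
def Sub.resTail {n m : ℕ} {σ : Pd n} {τ : Pd (n + 1)} {υ : Pd m} (g : Sub τ → Sub υ) :
    Sub (.cons σ τ) → Sub υ :=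
  fold g fun _ K => K

/-- Composite assignment: given an assignment `S` for `τ` and an assignment `K` for the total shape
of `S`, assign to a cell `p` of `τ` the total shape of the restriction of `K` to `S.at p`. -/
def Sub.bind : ∀ {n : ℕ} {τ : Pd n} (S : Sub τ), Sub S.total → Sub τ
  | _, _, .pt, _ => .pt
  | _, _, .nil, _ => .nil
  | _, _, .cnil R, K => .cnil (R.bind K)
  | _, _, .ccons S R, K => bindCons (σ := S.total) S.bind R.bind K

/-- The restriction to `S.at p` of an assignment for the total shape of `S`. -/
def Sub.res : ∀ {n : ℕ} {τ : Pd n} (S : Sub τ), Sub S.total → ∀ {k : ℕ} (p : Pos τ k), Sub (S.at p)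
  | _, _, .pt, _, _, .pt => .pt
  | _, _, .nil, _, _, .nil => .pt
  | _, _, .cnil _, _, _, .vert => .pt
  | _, _, .cnil _, _, _, .up _ => .nil
  | _, _, .cnil R, K, _, .tail p => R.res K p
  | _, _, .ccons _ _, _, _, .vert => .pt
  | _, _, .ccons S R, K, _, .up p =>
    resUp (σ := S.total) (fun L => S.res L p) (fun L => R.res L (.up p)) K
  | _, _, .ccons S R, K, _, .tail p => resTail (σ := S.total) (fun L => R.res L (.tail p)) K

theorem Sub.total_bindCons {n : ℕ} {σ ρ : Pd n} {τ υ : Pd (n + 1)} {f : Sub σ → Sub ρ}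
    {g : Sub τ → Sub (.cons ρ υ)} (hf : ∀ L, (f L).total = L.total)
    (hg : ∀ L, (g L).total = L.total) :
    ∀ K : Sub (.cons σ τ), (bindCons f g K).total = K.total
  | .cnil K => hg K
  | .ccons L K => congrArg₂ Pd.cons (hf L) (total_bindCons hf hg K)

theorem Sub.total_bind {n : ℕ} {τ : Pd n} (S : Sub τ) (K : Sub S.total) :
    (S.bind K).total = K.total := by
  induction S with
  | pt => cases K; rfl
  | nil => cases K; rfl
  | cnil R ih => exact ih K
  | ccons S R ih1 ih2 => exact total_bindCons ih1 ih2 K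

theorem Sub.at_bindCons_up {n m : ℕ} {σ ρ : Pd n} {τ υ : Pd (n + 1)} {f : Sub σ → Sub ρ}
    {g : Sub τ → Sub (.cons ρ υ)} {p : Pos ρ m} {ξ : Pd m} {ζ : Pd (m + 1)} {f' : Sub σ → Sub ξ}
    {g' : Sub τ → Sub ζ} (hf : ∀ L, (f L).at p = (f' L).total)
    (hg : ∀ L, (g L).at (.up p) = (g' L).total) :
    ∀ K : Sub (.cons σ τ), (bindCons f g K).at (.up p) = (resUp f' g' K).total
  | .cnil K => hg K
  | .ccons L K => congrArg₂ Pd.cons (hf L) (at_bindCons_up hf hg K)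

theorem Sub.at_bindCons_tail {n m : ℕ} {σ ρ : Pd n} {τ υ : Pd (n + 1)} {f : Sub σ → Sub ρ}
    {g : Sub τ → Sub (.cons ρ υ)} {p : Pos υ m} {ζ : Pd m}
    {g' : Sub τ → Sub ζ} (hg : ∀ L, (g L).at (.tail p) = (g' L).total) :
    ∀ K : Sub (.cons σ τ), (bindCons f g K).at (.tail p) = (resTail g' K).total
  | .cnil K => hg K
  | .ccons _ K => at_bindCons_tail (f := f) hg K

theorem Sub.at_bindCons_vert {n : ℕ} {σ ρ : Pd n} {τ υ : Pd (n + 1)} (f : Sub σ → Sub ρ)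
    (g : Sub τ → Sub (.cons ρ υ)) (K : Sub (.cons σ τ)) :
    (bindCons f g K).at .vert = .pt := Pd.eq_pt _

theorem Sub.at_bind {n : ℕ} {τ : Pd n} (S : Sub τ) (K : Sub S.total) {k : ℕ} (p : Pos τ k) :
    (S.bind K).at p = (S.res K p).total := by
  induction S generalizing k with
  | pt => cases p; rfl
  | nil => cases p; rfl
  | cnil R ih => cases p with
    | vert => rfl
    | up p => rfl
    | tail p => exact ih K p
  | ccons S R ih1 ih2 => cases p with
    | vert => exact Pd.eq_pt _
    | up p => exact at_bindCons_up (fun L => ih1 L p) (fun L => ih2 L (.up p)) K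
    | tail p => exact at_bindCons_tail (fun L => ih2 L (.tail p)) K

theorem Sub.at_resUp {n m : ℕ} {σ : Pd n} {ρ : Pd m} {τ : Pd (n + 1)} {υ : Pd (m + 1)}
    {f : Sub σ → Sub ρ} {g : Sub τ → Sub υ} {a : ∀ k, Pos ρ k → Pos σ k}
    {b : ∀ k, Pos υ k → Pos τ k} (hf : ∀ L k (q : Pos ρ k), (f L).at q = L.at (a k q))
    (hg : ∀ L k (q : Pos υ k), (g L).at q = L.at (b k q)) :
    ∀ (K : Sub (.cons σ τ)) (k : ℕ) (q : Pos (.cons ρ υ) k),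
      (resUp f g K).at q = K.at (.mapCons a b q)
  | .cnil K, _, .vert => rfl
  | .cnil K, _, .up q => rfl
  | .cnil K, _, .tail q => hg K _ q
  | .ccons L K, _, .vert => rfl
  | .ccons L K, _, .up q => congrArg₂ Pd.cons (hf L _ q) (at_resUp hf hg K _ (.up q))
  | .ccons _ K, _, .tail q => at_resUp hf hg K _ (.tail q)

theorem Sub.at_resTail {n m : ℕ} {σ : Pd n} {τ : Pd (n + 1)} {υ : Pd m}
    {g : Sub τ → Sub υ} {b : ∀ k, Pos υ k → Pos τ k}
    (hg : ∀ L k (q : Pos υ k), (g L).at q = L.at (b k q)) :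
    ∀ (K : Sub (.cons σ τ)) (k : ℕ) (q : Pos υ k),
      (resTail g K).at q = K.at (.tail (b k q))
  | .cnil K, _, q => hg K _ q
  | .ccons _ K, _, q => at_resTail hg K _ q

theorem Sub.at_res {n : ℕ} {τ : Pd n} (S : Sub τ) (K : Sub S.total) {k : ℕ} (p : Pos τ k)
    {m : ℕ} (q : Pos (S.at p) m) : (S.res K p).at q = K.at (S.emb p q) := by
  induction S generalizing k m with
  | pt => cases p; cases q; exact Pd.zero_eq _ _
  | nil => cases p; cases q; exact Pd.zero_eq _ _
  | cnil R ih => cases p with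
    | vert => cases q; exact Pd.zero_eq _ _
    | up p => cases q; exact Pd.zero_eq _ _
    | tail p => exact ih K p q
  | ccons S R ih1 ih2 => cases p with
    | vert => cases q; exact Pd.zero_eq _ _
    | up p => exact at_resUp (fun L _ q => ih1 L p q) (fun L _ q => ih2 L (.up p) q) K _ q
    | tail p => exact at_resTail (fun L _ q => ih2 L (.tail p) q) K _ q

theorem Sub.emb_resUp {n m : ℕ} {σ ρ : Pd n} {τ υ : Pd (n + 1)} {f : Sub σ → Sub ρ}
    {g : Sub τ → Sub (.cons ρ υ)} {p : Pos ρ m} {ξ : Pd m} {ζ : Pd (m + 1)} {f' : Sub σ → Sub ξ}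
    {g' : Sub τ → Sub ζ} {a : ∀ k, Pos ξ k → Pos σ k} {b : ∀ k, Pos ζ k → Pos τ k}
    (hf₁ : ∀ L, (f L).at p = (f' L).total) (hg₁ : ∀ L, (g L).at (.up p) = (g' L).total)
    (hf₂ : ∀ L, (f L).total = L.total) (hg₂ : ∀ L, (g L).total = L.total)
    (hf₃ : ∀ L k (q : Pos ξ k), (f' L).at q = L.at (a k q))
    (hg₃ : ∀ L k (q : Pos ζ k), (g' L).at q = L.at (b k q))
    (hf : ∀ L k (q : Pos ξ k) l (r : Pos ((f' L).at q) l),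
      ((f L).emb p (((f' L).emb q r).cast (hf₁ L).symm)).cast (hf₂ L) =
        L.emb (a k q) (r.cast (hf₃ L k q)))
    (hg : ∀ L k (q : Pos ζ k) l (r : Pos ((g' L).at q) l),
      ((g L).emb (.up p) (((g' L).emb q r).cast (hg₁ L).symm)).cast (hg₂ L) =
        L.emb (b k q) (r.cast (hg₃ L k q))) :
    ∀ (K : Sub (.cons σ τ)) (k : ℕ) (q : Pos (.cons ξ ζ) k) (l : ℕ)
      (r : Pos ((resUp f' g' K).at q) l),
      ((bindCons f g K).emb (.up p)
        (((resUp f' g' K).emb q r).cast (at_bindCons_up hf₁ hg₁ K).symm)).cast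
          (total_bindCons hf₂ hg₂ K) =
        K.emb (.mapCons a b q) (r.cast (at_resUp hf₃ hg₃ K k q))
  | .cnil K, _, .vert, _, r => by
    change Pos .pt _ at r; cases r
    change ((g K).emb (.up p) ((Pos.first (g' K).total).cast (hg₁ K).symm)).cast (hg₂ K) =
      .first K.total
    rw [Pos.cast_first, emb_up_first, Pos.cast_first]
  | .cnil K, _, .up q, _, r => by
    change Pos .nil _ at r; cases r
    change ((g K).emb (.up p) ((Pos.first (g' K).total).cast (hg₁ K).symm)).cast (hg₂ K) =
      .first K.total
    rw [Pos.cast_first, emb_up_first, Pos.cast_first]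
  | .cnil K, _, .tail q, _, r => hg K _ q _ r
  | .ccons L K, _, .vert, _, r => by
    change Pos .pt _ at r; cases r
    erw [Pos.cast_vert, Pos.cast_vert]; rfl
  | .ccons L K, _, .up q, _, r => by
    have ih := emb_resUp hf₁ hg₁ hf₂ hg₂ hf₃ hg₃ hf hg K _ (.up q)
    change Pos (.cons _ _) _ at r
    cases r with
    | vert => erw [Pos.cast_vert, Pos.cast_vert, Pos.cast_vert]; rfl
    | up r =>
      erw [Pos.cast_up (hf₁ L).symm, Pos.cast_up (hf₂ L), Pos.cast_up (hf₃ L _ q)]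
      exact congrArg Pos.up (hf L _ q _ r)
    | tail r =>
      erw [Pos.cast_tail (at_bindCons_up hf₁ hg₁ K).symm,
        Pos.cast_tail (total_bindCons hf₂ hg₂ K), Pos.cast_tail (at_resUp hf₃ hg₃ K _ (.up q))]
      exact congrArg Pos.tail (ih _ r)
  | .ccons L K, _, .tail q, _, r => by
    have ih := emb_resUp hf₁ hg₁ hf₂ hg₂ hf₃ hg₃ hf hg K _ (.tail q)
    erw [Pos.cast_tail (at_bindCons_up hf₁ hg₁ K).symm,
      Pos.cast_tail (total_bindCons hf₂ hg₂ K)]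
    exact congrArg Pos.tail (ih _ r)

theorem Sub.emb_resTail {n m : ℕ} {σ ρ : Pd n} {τ υ : Pd (n + 1)} {f : Sub σ → Sub ρ}
    {g : Sub τ → Sub (.cons ρ υ)} {p : Pos υ m} {ζ : Pd m}
    {g' : Sub τ → Sub ζ} {b : ∀ k, Pos ζ k → Pos τ k}
    (hg₁ : ∀ L, (g L).at (.tail p) = (g' L).total)
    (hf₂ : ∀ L, (f L).total = L.total) (hg₂ : ∀ L, (g L).total = L.total)
    (hg₃ : ∀ L k (q : Pos ζ k), (g' L).at q = L.at (b k q))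
    (hg : ∀ L k (q : Pos ζ k) l (r : Pos ((g' L).at q) l),
      ((g L).emb (.tail p) (((g' L).emb q r).cast (hg₁ L).symm)).cast (hg₂ L) =
        L.emb (b k q) (r.cast (hg₃ L k q))) :
    ∀ (K : Sub (.cons σ τ)) (k : ℕ) (q : Pos ζ k) (l : ℕ)
      (r : Pos ((resTail g' K).at q) l),
      ((bindCons f g K).emb (.tail p)
        (((resTail g' K).emb q r).cast (at_bindCons_tail hg₁ K).symm)).cast
          (total_bindCons hf₂ hg₂ K) =
        K.emb (.tail (b k q)) (r.cast (at_resTail hg₃ K k q))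
  | .cnil K, _, q, _, r => hg K _ q _ r
  | .ccons L K, _, q, _, r => by
    have ih := emb_resTail hg₁ hf₂ hg₂ hg₃ hg K _ q
    erw [Pos.cast_tail (total_bindCons hf₂ hg₂ K)]
    exact congrArg Pos.tail (ih _ r)

theorem Sub.emb_res {n : ℕ} {τ : Pd n} (S : Sub τ) (K : Sub S.total) {k : ℕ} (p : Pos τ k)
    {m : ℕ} (q : Pos (S.at p) m) {l : ℕ} (r : Pos ((S.res K p).at q) l) :
    ((S.bind K).emb p (((S.res K p).emb q r).cast (S.at_bind K p).symm)).cast (S.total_bind K) =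
      K.emb (S.emb p q) (r.cast (S.at_res K p q)) := by
  induction S generalizing k m l with
  | pt => cases K; cases p; cases q; cases r; rfl
  | nil => cases K; cases p; cases q; cases r; rfl
  | cnil R ih => cases p with
    | vert =>
      cases q; cases r
      exact (Pos.cast_first _).trans (Sub.emb_first (τ := R.total) K _).symm
    | up p =>
      cases q; cases r
      exact (Pos.cast_first _).trans (Sub.emb_first (τ := R.total) K _).symm
    | tail p => exact ih K p q r
  | ccons S R ih1 ih2 => cases p with
    | vert =>
      cases q; cases r
      have h : (Pos.first ((S.ccons R).bind K).total).cast ((S.ccons R).total_bind K) =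
        .first K.total := Pos.cast_first _
      rw [← Sub.emb_first ((S.ccons R).bind K) (.cast ((S.ccons R).at_bind K _).symm .pt)] at h
      exact h.trans (Sub.emb_first (τ := (S.ccons R).total) K _).symm
    | up p =>
      exact emb_resUp (fun L => S.at_bind L p) (fun L => R.at_bind L (.up p)) S.total_bind
        R.total_bind (fun L _ q => S.at_res L p q) (fun L _ q => R.at_res L (.up p) q)
        (fun L _ q _ r => ih1 L p q r) (fun L _ q _ r => ih2 L (.up p) q r) K _ q _ r
    | tail p =>
      exact emb_resTail (fun L => R.at_bind L (.tail p)) S.total_bind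
        R.total_bind (fun L _ q => R.at_res L (.tail p) q)
        (fun L _ q _ r => ih2 L (.tail p) q r) K _ q _ r

/-- A family of shapes indexed by the cells of `τ` is compatible with boundaries, that is, it is a
pasting diagram of shape `τ` in the globular set of shapes. -/
def IsShape {n : ℕ} {τ : Pd n} (f : ∀ k : ℕ, Pos τ k → Pd k) : Prop :=
  ∀ (k : ℕ) (p : Pos τ (k + 1)), f k p.src = (f (k + 1) p).bdry ∧ f k p.tgt = (f (k + 1) p).bdry

/-- The number of entries of a list. -/
def Pd.len : ∀ {m : ℕ}, Pd m → ℕ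
  | _, .pt => 0
  | _, .nil => 0
  | _, .cons _ τ => τ.len + 1

/-- The first entry of a list (with an irrelevant value for the empty list). -/
def Pd.head : ∀ {k : ℕ}, Pd (k + 1) → Pd k
  | k, .nil => .simple k
  | _, .cons σ _ => σ

/-- The list without its first entry. -/
def Pd.rest : ∀ {k : ℕ}, Pd (k + 1) → Pd (k + 1)
  | _, .nil => .nil
  | _, .cons _ τ => τ

/-- Auxiliary recursion for `Sub.of`. -/
def Sub.ofAux {n : ℕ} {σ : Pd n} {τ : Pd (n + 1)} (F : (∀ k : ℕ, Pos σ k → Pd k) → Sub σ)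
    (R : Sub τ) : ℕ → (∀ k : ℕ, Pos σ k → Pd (k + 1)) → Sub (.cons σ τ)
  | 0, _ => .cnil R
  | l + 1, g => .ccons (F fun k p => (g k p).head) (ofAux F R l fun k p => (g k p).rest)

/-- The assignment with given values `f`, provided that `f` is compatible with boundaries. -/
def Sub.of : ∀ {n : ℕ} (τ : Pd n), (∀ k : ℕ, Pos τ k → Pd k) → Sub τ
  | _, .pt, _ => .pt
  | _, .nil, _ => .nil
  | _, .cons σ τ, f => ofAux (of σ) (of τ fun k p => f k (.tail p)) (f 1 (.up (.first σ))).len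
      fun k p => f (k + 1) (.up p)

theorem Sub.isShape {n : ℕ} {τ : Pd n} (S : Sub τ) : IsShape fun _ p => S.at p :=
  fun _ p => ⟨(S.bdry_at_src p).symm, (S.bdry_at_tgt p).symm⟩

theorem Sub.of_at {n : ℕ} {τ : Pd n} (S : Sub τ) : Sub.of τ (fun _ p => S.at p) = S := by
  induction S with
  | pt => rfl
  | nil => rfl
  | cnil R ih => exact congrArg Sub.cnil ih
  | ccons S R ih1 ih2 => exact congrArg₂ Sub.ccons ih1 ih2

theorem Pos.first_induction {n : ℕ} {τ : Pd n} (Q : ∀ k : ℕ, Pos τ k → Prop)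
    (hs : ∀ k (p : Pos τ (k + 1)), Q k p.src ↔ Q (k + 1) p)
    (ht : ∀ k (p : Pos τ (k + 1)), Q k p.tgt ↔ Q (k + 1) p) (k : ℕ) (p : Pos τ k) :
    Q 0 (.first τ) ↔ Q k p := by
  induction τ generalizing k with
  | pt => cases p; rfl
  | nil => cases p; rfl
  | cons σ τ ih1 ih2 =>
    have key : ∀ (k) (p : Pos σ k), Q 0 .vert ↔ Q (k + 1) (.up p) := by
      intro k
      induction k with
      | zero => exact fun p => hs 0 (.up p)
      | succ k ih => exact fun p => (ih p.src).trans (hs (k + 1) (.up p))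
    cases p with
    | vert => rfl
    | up p => exact key _ p
    | tail p =>
      refine ((key 0 (.first σ)).trans (ht 0 (.up (.first σ))).symm).trans
        (ih2 (fun k p => Q k (.tail p)) (fun k p => ?_) (fun k p => ?_) k p)
      · rw [← hs, Pos.src_tail]
      · rw [← ht, Pos.tgt_tail]

theorem Pd.len_bdry : ∀ {n : ℕ} (τ : Pd (n + 2)), τ.bdry.len = τ.len
  | _, .nil => rfl
  | _, .cons _ τ => congrArg (· + 1) (len_bdry τ)

theorem Pd.head_bdry {n : ℕ} (τ : Pd (n + 2)) (h : τ.len ≠ 0) : τ.bdry.head = τ.head.bdry := by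
  cases τ with
  | nil => exact (h rfl).elim
  | cons σ τ => rfl

theorem Pd.rest_bdry {n : ℕ} (τ : Pd (n + 2)) : τ.bdry.rest = τ.rest.bdry := by
  cases τ <;> rfl

theorem Pd.eq_nil {n : ℕ} {τ : Pd (n + 1)} (h : τ.len = 0) : τ = .nil := by
  cases τ with
  | nil => rfl
  | cons σ τ => cases h

theorem Pd.cons_head_rest {n : ℕ} {τ : Pd (n + 1)} (h : τ.len ≠ 0) :
    Pd.cons τ.head τ.rest = τ := by
  cases τ with
  | nil => exact (h rfl).elim
  | cons σ τ => rfl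

theorem Pd.len_rest {n : ℕ} (τ : Pd (n + 1)) : τ.rest.len = τ.len - 1 := by
  cases τ <;> rfl

theorem Sub.exists_at_eq {n : ℕ} {τ : Pd n} {f : ∀ k : ℕ, Pos τ k → Pd k} (hf : IsShape f) :
    ∃ S : Sub τ, f = fun _ p => S.at p := by
  induction τ with
  | pt => exact ⟨.pt, by funext k p; cases p; exact Pd.zero_eq _ _⟩
  | nil => exact ⟨.nil, by funext k p; cases p; exact Pd.zero_eq _ _⟩
  | cons σ τ ih1 ih2 =>
    obtain ⟨l, hl⟩ : ∃ l, (f 1 (.up (.first σ))).len = l := ⟨_, rfl⟩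
    have hlen : ∀ {f : ∀ k : ℕ, Pos (.cons σ τ) k → Pd k}, IsShape f → ∀ k (p : Pos σ k),
        (f 1 (.up (.first σ))).len = (f (k + 1) (.up p)).len := by
      intro f hf k p
      refine (Pos.first_induction
        (fun k p => (f 1 (.up (.first σ))).len = (f (k + 1) (.up p)).len) ?_ ?_ k p).1 rfl
      · intro k p
        have := (hf (k + 1) (.up p)).1
        simp only [Pos.src] at this
        rw [this, Pd.len_bdry]
      · intro k p
        have := (hf (k + 1) (.up p)).2
        simp only [Pos.tgt] at this
        rw [this, Pd.len_bdry]
    induction l generalizing f with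
    | zero =>
      obtain ⟨R, hR⟩ := ih2 (f := fun k p => f k (.tail p)) fun k p => by
        have := hf k (.tail p)
        rwa [Pos.src_tail, Pos.tgt_tail] at this
      refine ⟨.cnil R, ?_⟩
      funext k p
      cases p with
      | vert => exact Pd.zero_eq _ _
      | up p => exact Pd.eq_nil ((hlen hf _ p).symm.trans hl)
      | tail p => exact congrFun (congrFun hR _) p
    | succ l ih =>
      have hne : ∀ k (p : Pos σ k), (f (k + 1) (.up p)).len ≠ 0 := by
        intro k p
        rw [← hlen hf k p, hl]
        exact Nat.succ_ne_zero l
      obtain ⟨S, hS⟩ := ih1 (f := fun k p => (f (k + 1) (.up p)).head) fun k p => by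
        rw [← Pd.head_bdry _ (hne _ p)]
        exact ⟨congrArg _ (hf (k + 1) (.up p)).1, congrArg _ (hf (k + 1) (.up p)).2⟩
      let f' : ∀ k : ℕ, Pos (.cons σ τ) k → Pd k := fun k p => match k, p with
        | _, .vert => .pt
        | _, .up p => (f _ (.up p)).rest
        | _, .tail p => f _ (.tail p)
      have hf' : IsShape f' := by
        intro k p
        cases p with
        | up p => cases k with
          | zero => exact ⟨Pd.zero_eq _ _, Pd.zero_eq _ _⟩
          | succ k =>
            have h := hf (k + 1) (.up p)
            exact ⟨(congrArg Pd.rest h.1).trans (Pd.rest_bdry _),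
              (congrArg Pd.rest h.2).trans (Pd.rest_bdry _)⟩
        | tail p =>
          have h := hf k (.tail p)
          rw [Pos.src_tail, Pos.tgt_tail] at h ⊢
          exact h
      obtain ⟨R, hR⟩ := ih hf' ((Pd.len_rest _).trans (by rw [hl]; rfl))
      refine ⟨.ccons S R, ?_⟩
      funext k p
      cases p with
      | vert => exact Pd.zero_eq _ _
      | up p =>
        rw [← Pd.cons_head_rest (hne _ p)]
        exact congrArg₂ Pd.cons (congrFun (congrFun hS _) p) (congrFun (congrFun hR _) (.up p))
      | tail p => exact congrFun (congrFun hR _) (.tail p)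

theorem Sub.at_of {n : ℕ} {τ : Pd n} {f : ∀ k : ℕ, Pos τ k → Pd k} (hf : IsShape f) {k : ℕ}
    (p : Pos τ k) : (Sub.of τ f).at p = f k p := by
  obtain ⟨S, rfl⟩ := Sub.exists_at_eq hf
  rw [Sub.of_at]

/-- The shape obtained from `τ` by replacing every cell `p` by the shape `f p`. -/
def Pd.subst {n : ℕ} (τ : Pd n) (f : ∀ k : ℕ, Pos τ k → Pd k) : Pd n := (Sub.of τ f).total

/-- If `ρ` is obtained from `τ` by replacing every cell `p` by the shape `f p`, then the cells of
`f p` are cells of `ρ`. -/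
def Pos.emb {n : ℕ} {τ : Pd n} {f : ∀ k : ℕ, Pos τ k → Pd k} (hf : IsShape f) {ρ : Pd n}
    (h : τ.subst f = ρ) {k : ℕ} (p : Pos τ k) {m : ℕ} (q : Pos (f k p) m) : Pos ρ m :=
  ((Sub.of τ f).emb p (q.cast (Sub.at_of hf p).symm)).cast h

theorem Sub.subst_at {n : ℕ} {τ : Pd n} (S : Sub τ) : τ.subst (fun _ p => S.at p) = S.total :=
  congrArg Sub.total S.of_at

theorem Sub.pos_emb {n : ℕ} {τ : Pd n} (S : Sub τ) (hf : IsShape fun _ p => S.at p) {ρ : Pd n}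
    (h : τ.subst (fun _ p => S.at p) = ρ) {k : ℕ} (p : Pos τ k) {m : ℕ} (q : Pos (S.at p) m) :
    Pos.emb hf h p q = (S.emb p q).cast (S.subst_at.symm.trans h) := by
  subst h
  have aux : ∀ (S' : Sub τ) (hS : S' = S) (h₁ : S.at p = S'.at p) (h₂ : S.total = S'.total),
      S'.emb p (q.cast h₁) = (S.emb p q).cast h₂ := by
    intro S' hS _ _
    subst hS; rfl
  exact aux _ S.of_at _ _

theorem Pos.emb_src {n : ℕ} {τ : Pd n} {f : ∀ k : ℕ, Pos τ k → Pd k} (hf : IsShape f) {ρ : Pd n}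
    (h : τ.subst f = ρ) {k : ℕ} (p : Pos τ k) {m : ℕ} (q : Pos (f k p) (m + 1)) :
    emb hf h p q.src = (emb hf h p q).src := by
  rw [emb, ← Pos.cast_src, Sub.emb_src]; exact (Pos.cast_src h _).symm

theorem Pos.emb_tgt {n : ℕ} {τ : Pd n} {f : ∀ k : ℕ, Pos τ k → Pd k} (hf : IsShape f) {ρ : Pd n}
    (h : τ.subst f = ρ) {k : ℕ} (p : Pos τ k) {m : ℕ} (q : Pos (f k p) (m + 1)) :
    emb hf h p q.tgt = (emb hf h p q).tgt := by
  rw [emb, ← Pos.cast_tgt, Sub.emb_tgt]; exact (Pos.cast_tgt h _).symm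

theorem Pos.emb_src_eq {n : ℕ} {τ : Pd n} {f : ∀ k : ℕ, Pos τ k → Pd k} (hf : IsShape f)
    {ρ : Pd n} (h : τ.subst f = ρ) {k : ℕ} (p : Pos τ (k + 1)) {m : ℕ}
    (q : Pos (f k p.src) m) (h' : f k p.src = (f (k + 1) p).bdry) :
    emb hf h p.src q = emb hf h p (inclS _ (q.cast h')) := by
  obtain ⟨S, rfl⟩ := Sub.exists_at_eq hf
  rw [S.pos_emb, S.pos_emb, ← S.emb_src_eq, Pos.cast_cast]; rfl

theorem Pos.emb_tgt_eq {n : ℕ} {τ : Pd n} {f : ∀ k : ℕ, Pos τ k → Pd k} (hf : IsShape f)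
    {ρ : Pd n} (h : τ.subst f = ρ) {k : ℕ} (p : Pos τ (k + 1)) {m : ℕ}
    (q : Pos (f k p.tgt) m) (h' : f k p.tgt = (f (k + 1) p).bdry) :
    emb hf h p.tgt q = emb hf h p (inclT _ (q.cast h')) := by
  obtain ⟨S, rfl⟩ := Sub.exists_at_eq hf
  rw [S.pos_emb, S.pos_emb, ← S.emb_tgt_eq, Pos.cast_cast]; rfl

theorem IsShape.inclS {n : ℕ} {τ : Pd (n + 1)} {f : ∀ k : ℕ, Pos τ k → Pd k} (hf : IsShape f) :
    IsShape fun k (p : Pos τ.bdry k) => f k (.inclS τ p) := fun k p => by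
  dsimp only; rw [Pos.inclS_src, Pos.inclS_tgt]; exact hf k _

theorem IsShape.inclT {n : ℕ} {τ : Pd (n + 1)} {f : ∀ k : ℕ, Pos τ k → Pd k} (hf : IsShape f) :
    IsShape fun k (p : Pos τ.bdry k) => f k (.inclT τ p) := fun k p => by
  dsimp only; rw [Pos.inclT_src, Pos.inclT_tgt]; exact hf k _

theorem Pd.subst_inclS {n : ℕ} {τ : Pd (n + 1)} {f : ∀ k : ℕ, Pos τ k → Pd k} (hf : IsShape f) :
    (τ.bdry.subst fun k p => f k (.inclS τ p)) = (τ.subst f).bdry := by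
  obtain ⟨S, rfl⟩ := Sub.exists_at_eq hf
  simp only [← S.at_bdry_inclS, Sub.subst_at, Sub.total_bdry]

theorem Pd.subst_inclT {n : ℕ} {τ : Pd (n + 1)} {f : ∀ k : ℕ, Pos τ k → Pd k} (hf : IsShape f) :
    (τ.bdry.subst fun k p => f k (.inclT τ p)) = (τ.subst f).bdry := by
  obtain ⟨S, rfl⟩ := Sub.exists_at_eq hf
  simp only [← S.at_bdry_inclT, Sub.subst_at, Sub.total_bdry]

theorem Sub.pos_emb' {n : ℕ} {τ : Pd n} (S : Sub τ) {f : ∀ k : ℕ, Pos τ k → Pd k}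
    (hS : ∀ k p, f k p = S.at p) (hf : IsShape f) {ρ : Pd n}
    (h : τ.subst f = ρ) (h' : S.total = ρ) {k : ℕ} (p : Pos τ k) {m : ℕ} (q : Pos (f k p) m) :
    Pos.emb hf h p q = (S.emb p (q.cast (hS k p))).cast h' := by
  obtain rfl : f = fun _ p => S.at p := by funext k p; exact hS k p
  exact S.pos_emb hf h p q

theorem Pos.inclS_cast {n : ℕ} {ρ ρ' : Pd (n + 1)} (h : ρ = ρ') {k : ℕ} (p : Pos ρ.bdry k) :
    inclS ρ' (p.cast (congrArg Pd.bdry h)) = (inclS ρ p).cast h := by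
  subst h; rfl

theorem Pos.inclT_cast {n : ℕ} {ρ ρ' : Pd (n + 1)} (h : ρ = ρ') {k : ℕ} (p : Pos ρ.bdry k) :
    inclT ρ' (p.cast (congrArg Pd.bdry h)) = (inclT ρ p).cast h := by
  subst h; rfl

theorem Pos.inclS_emb {n : ℕ} {τ : Pd (n + 1)} {f : ∀ k : ℕ, Pos τ k → Pd k} (hf : IsShape f)
    {ρ : Pd (n + 1)} (h : τ.subst f = ρ)
    (hf' : IsShape fun k (p : Pos τ.bdry k) => f k (.inclS τ p))
    (h' : (τ.bdry.subst fun k p => f k (.inclS τ p)) = ρ.bdry) {k : ℕ} (p : Pos τ.bdry k) {m : ℕ}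
    (q : Pos (f k (.inclS τ p)) m) : inclS ρ (emb hf' h' p q) = emb hf h (inclS τ p) q := by
  obtain ⟨S, rfl⟩ := Sub.exists_at_eq hf
  rw [S.pos_emb, S.bdry.pos_emb' (fun k p => (S.at_bdry_inclS k p).symm) _ _
    (S.total_bdry.trans (congrArg Pd.bdry (S.subst_at.symm.trans h)))]
  rw [← Pos.cast_cast S.total_bdry (congrArg Pd.bdry (S.subst_at.symm.trans h)),
    Pos.inclS_cast, S.emb_bdry_inclS, Pos.cast_cast]; rfl

theorem Pos.inclT_emb {n : ℕ} {τ : Pd (n + 1)} {f : ∀ k : ℕ, Pos τ k → Pd k} (hf : IsShape f)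
    {ρ : Pd (n + 1)} (h : τ.subst f = ρ)
    (hf' : IsShape fun k (p : Pos τ.bdry k) => f k (.inclT τ p))
    (h' : (τ.bdry.subst fun k p => f k (.inclT τ p)) = ρ.bdry) {k : ℕ} (p : Pos τ.bdry k) {m : ℕ}
    (q : Pos (f k (.inclT τ p)) m) : inclT ρ (emb hf' h' p q) = emb hf h (inclT τ p) q := by
  obtain ⟨S, rfl⟩ := Sub.exists_at_eq hf
  rw [S.pos_emb, S.bdry.pos_emb' (fun k p => (S.at_bdry_inclT k p).symm) _ _
    (S.total_bdry.trans (congrArg Pd.bdry (S.subst_at.symm.trans h)))]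
  rw [← Pos.cast_cast S.total_bdry (congrArg Pd.bdry (S.subst_at.symm.trans h)),
    Pos.inclT_cast, S.emb_bdry_inclT, Pos.cast_cast]; rfl

theorem IsShape.emb {n : ℕ} {τ : Pd n} {f : ∀ k : ℕ, Pos τ k → Pd k} (hf : IsShape f) {ρ : Pd n}
    (h : τ.subst f = ρ) {g : ∀ k : ℕ, Pos ρ k → Pd k} (hg : IsShape g)
    {k : ℕ} (p : Pos τ k) : IsShape fun m q => g m (.emb hf h p q) := fun k q => by
  dsimp only; rw [Pos.emb_src, Pos.emb_tgt]; exact hg k _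

theorem Pd.subst_subst_aux {n : ℕ} {τ : Pd n} {f : ∀ k : ℕ, Pos τ k → Pd k} (hf : IsShape f) {ρ : Pd n}
    (h : τ.subst f = ρ) {g : ∀ k : ℕ, Pos ρ k → Pd k} (hg : IsShape g)
    (S : Sub τ) (hS : f = fun _ p => S.at p) : ∃ K : Sub S.total, ρ.subst g = K.total ∧
      ∀ k p, (f k p).subst (fun m q => g m (.emb hf h p q)) = (S.bind K).at p := by
  subst hS
  obtain rfl : S.total = ρ := S.subst_at.symm.trans h
  obtain ⟨K, rfl⟩ := Sub.exists_at_eq hg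
  refine ⟨K, K.subst_at, fun k p => ?_⟩
  rw [S.at_bind, ← (S.res K p).subst_at]
  simp only [S.at_res, S.pos_emb]; rfl

theorem IsShape.subst {n : ℕ} {τ : Pd n} {f : ∀ k : ℕ, Pos τ k → Pd k} (hf : IsShape f) {ρ : Pd n}
    (h : τ.subst f = ρ) {g : ∀ k : ℕ, Pos ρ k → Pd k} (hg : IsShape g) :
    IsShape fun k p => (f k p).subst fun m q => g m (.emb hf h p q) := by
  obtain ⟨S, hS⟩ := Sub.exists_at_eq hf
  obtain ⟨K, -, h2⟩ := Pd.subst_subst_aux hf h hg S hS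
  simp only [h2]
  exact (S.bind K).isShape

theorem Pd.subst_subst {n : ℕ} {τ : Pd n} {f : ∀ k : ℕ, Pos τ k → Pd k} (hf : IsShape f) {ρ : Pd n}
    (h : τ.subst f = ρ) {g : ∀ k : ℕ, Pos ρ k → Pd k} (hg : IsShape g) :
    (τ.subst fun k p => (f k p).subst fun m q => g m (.emb hf h p q)) = ρ.subst g := by
  obtain ⟨S, hS⟩ := Sub.exists_at_eq hf
  obtain ⟨K, h3, h2⟩ := Pd.subst_subst_aux hf h hg S hS
  simp only [h2, h3, Sub.subst_at, Sub.total_bind]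

theorem Pos.emb_emb {n : ℕ} {τ : Pd n} {f : ∀ k : ℕ, Pos τ k → Pd k} (hf : IsShape f) {ρ : Pd n}
    (h : τ.subst f = ρ) {g : ∀ k : ℕ, Pos ρ k → Pd k} (hg : IsShape g) {χ : Pd n} (hχ : ρ.subst g = χ)
    (hf₁ : IsShape fun k p => (f k p).subst fun m q => g m (.emb hf h p q))
    (h₁ : (τ.subst fun k p => (f k p).subst fun m q => g m (.emb hf h p q)) = χ)
    {k : ℕ} (p : Pos τ k) (hg₁ : IsShape fun m q => g m (.emb hf h p q))
    {m : ℕ} (q : Pos (f k p) m) {l : ℕ} (r : Pos (g m (.emb hf h p q)) l) :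
    emb hf₁ h₁ p (emb hg₁ rfl q r) = emb hg hχ (emb hf h p q) r := by
  obtain ⟨S, rfl⟩ := Sub.exists_at_eq hf
  obtain rfl : S.total = ρ := S.subst_at.symm.trans h
  obtain ⟨K, rfl⟩ := Sub.exists_at_eq hg
  have e1 : ∀ (k : ℕ) (p : Pos τ k) (m : ℕ) (q : Pos (S.at p) m),
      K.at (Pos.emb hf h p q) = (S.res K p).at q := fun k p m q => by
    rw [S.pos_emb]; exact (S.at_res _ _ _).symm
  have e2 : ∀ (k : ℕ) (p : Pos τ k), ((S.at p).subst fun m q => K.at (Pos.emb hf h p q)) =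
      (S.res K p).total := fun k p => by
    simp only [e1, Sub.subst_at]
  have e3 : K.total = χ := K.subst_at.symm.trans hχ
  subst e3
  rw [(S.bind K).pos_emb' (fun k p => (e2 k p).trans (S.at_bind K p).symm) _ _ (S.total_bind K),
    (S.res K p).pos_emb' (fun m q => e1 k p m q) _ _ (e2 k p).symm, Pos.cast_cast,
    S.emb_res, Pos.cast_cast]
  rw [K.pos_emb]
  have aux : ∀ (x y : Pos S.total m) (hxy : x = y) (h₁ : K.at y = K.at x) (r : Pos (K.at y) l),
      K.emb x (r.cast h₁) = K.emb y r := by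
    intro x y hxy _ r; subst hxy; rfl
  exact aux _ _ (by rw [S.pos_emb]; rfl) _ r


/-- The cell of top dimension of the simple `n`-pasting diagram. -/
def Pos.top : ∀ n : ℕ, Pos (.simple n) n
  | 0 => .pt
  | n + 1 => .up (top n)

theorem Pd.bdry_simple : ∀ n : ℕ, (Pd.simple (n + 1)).bdry = Pd.simple n
  | 0 => rfl
  | n + 1 => congrArg (Pd.cons · .nil) (bdry_simple n)

theorem Pos.inclS_top : ∀ n : ℕ,
    inclS (.simple (n + 1)) ((top n).cast (Pd.bdry_simple n).symm) = (top (n + 1)).src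
  | 0 => rfl
  | n + 1 => by
    have h := Pos.cast_up (Pd.bdry_simple n).symm (Pd.bdry_simple (n + 1)).symm (top n)
    exact (congrArg (inclS (.simple (n + 2))) h).trans (congrArg Pos.up (inclS_top n))

theorem Pos.inclT_top : ∀ n : ℕ,
    inclT (.simple (n + 1)) ((top n).cast (Pd.bdry_simple n).symm) = (top (n + 1)).tgt
  | 0 => rfl
  | n + 1 => by
    have h := Pos.cast_up (Pd.bdry_simple n).symm (Pd.bdry_simple (n + 1)).symm (top n)
    exact (congrArg (inclT (.simple (n + 2))) h).trans (congrArg Pos.up (inclT_top n))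

theorem Sub.total_simpleAux {n : ℕ} {σ : Pd n} {τ : Pd (n + 1)} {p : Pos σ n}
    (hσ : ∀ L : Sub σ, L.total = L.at p) (hτ : ∀ R : Sub τ, R.total = .nil) :
    ∀ S : Sub (.cons σ τ), S.total = S.at (.up p)
  | .cnil R => hτ R
  | .ccons S R => congrArg₂ Pd.cons (hσ S) (total_simpleAux hσ hτ R)

theorem Sub.total_nil {n : ℕ} : ∀ S : Sub (.nil : Pd (n + 1)), S.total = .nil
  | .nil => rfl

theorem Sub.total_simple : ∀ {n : ℕ} (S : Sub (.simple n)), S.total = S.at (.top n)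
  | 0, .pt => rfl
  | n + 1, S => total_simpleAux (fun L : Sub (.simple n) => L.total_simple) total_nil S

theorem Sub.emb_topAux {n : ℕ} {σ : Pd n} {τ : Pd (n + 1)} {p : Pos σ n}
    (hσ : ∀ L : Sub σ, L.total = L.at p) (hτ : ∀ R : Sub τ, R.total = .nil)
    (h : ∀ (L : Sub σ) (k : ℕ) (q : Pos (L.at p) k), L.emb p q = q.cast (hσ L).symm) :
    ∀ (S : Sub (.cons σ τ)) (k : ℕ) (q : Pos (S.at (.up p)) k),
      S.emb (.up p) q = q.cast (total_simpleAux hσ hτ S).symm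
  | .cnil R, _, q => by
    change Pos .nil _ at q; cases q
    exact (Pos.cast_first (hτ R).symm).symm
  | .ccons S R, _, q => by
    change Pos (.cons _ _) _ at q
    cases q with
    | vert => exact (Pos.cast_vert _).symm
    | up q => exact (congrArg Pos.up (h S _ q)).trans (Pos.cast_up (hσ S).symm _ q).symm
    | tail q =>
      exact (congrArg Pos.tail (emb_topAux hσ hτ h R _ q)).trans
        (Pos.cast_tail (total_simpleAux hσ hτ R).symm _ q).symm

theorem Sub.emb_top : ∀ {n : ℕ} (S : Sub (.simple n)) (k : ℕ) (q : Pos (S.at (.top n)) k),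
    S.emb (.top n) q = q.cast S.total_simple.symm
  | 0, .pt, _, _ => rfl
  | n + 1, S, k, q => emb_topAux (fun L : Sub (.simple n) => L.total_simple) total_nil
      (fun L k q => L.emb_top k q) S k q

theorem Pd.subst_simple {n : ℕ} {f : ∀ k : ℕ, Pos (.simple n) k → Pd k} (hf : IsShape f) :
    (Pd.simple n).subst f = f n (.top n) := by
  obtain ⟨S, rfl⟩ := Sub.exists_at_eq hf
  exact S.subst_at.trans S.total_simple

theorem Pos.emb_top {n : ℕ} {f : ∀ k : ℕ, Pos (.simple n) k → Pd k} (hf : IsShape f) {ρ : Pd n}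
    (h : (Pd.simple n).subst f = ρ) {k : ℕ} (q : Pos (f n (.top n)) k)
    (h' : f n (.top n) = ρ) : emb hf h (.top n) q = q.cast h' := by
  obtain ⟨S, rfl⟩ := Sub.exists_at_eq hf
  rw [S.pos_emb, S.emb_top, Pos.cast_cast]

/-- The assignment of simple shapes. -/
def Sub.one : ∀ {n : ℕ} (τ : Pd n), Sub τ
  | _, .pt => .pt
  | _, .nil => .nil
  | _, .cons σ τ => .ccons (one σ) (.cnil (one τ))

theorem Sub.at_one : ∀ {n : ℕ} (τ : Pd n) (k : ℕ) (p : Pos τ k), (one τ).at p = .simple k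
  | _, .pt, _, .pt => rfl
  | _, .nil, _, p => by cases p; rfl
  | _, .cons _ _, _, .vert => rfl
  | _, .cons σ _, _, .up p => congrArg (Pd.cons · .nil) (at_one σ _ p)
  | _, .cons _ τ, _, .tail p => at_one τ _ p

theorem Sub.total_one : ∀ {n : ℕ} (τ : Pd n), (one τ).total = τ
  | _, .pt => rfl
  | _, .nil => rfl
  | _, .cons σ τ => congrArg₂ Pd.cons (total_one σ) (total_one τ)

theorem Sub.emb_one : ∀ {n : ℕ} (τ : Pd n) (k : ℕ) (p : Pos τ k),
    (one τ).emb p ((Pos.top k).cast (at_one τ k p).symm) = p.cast (total_one τ).symm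
  | _, .pt, _, .pt => rfl
  | _, .nil, _, p => by cases p; rfl
  | _, .cons _ _, _, .vert => (Pos.cast_vert _).symm
  | _, .cons σ τ, _, .up p => by
    have h := Pos.cast_up (at_one σ _ p).symm (at_one (.cons σ τ) _ (.up p)).symm (.top _)
    exact ((congrArg ((one (.cons σ τ)).emb (.up p)) h).trans
      (congrArg Pos.up (emb_one σ _ p))).trans (Pos.cast_up (total_one σ).symm _ p).symm
  | _, .cons _ τ, _, .tail p =>
    (congrArg Pos.tail (emb_one τ _ p)).trans (Pos.cast_tail (total_one τ).symm _ p).symm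

theorem isShape_simple {n : ℕ} (τ : Pd n) : IsShape fun k (_ : Pos τ k) => .simple k :=
  fun k _ => ⟨(Pd.bdry_simple k).symm, (Pd.bdry_simple k).symm⟩

theorem Pd.subst_one {n : ℕ} (τ : Pd n) : (τ.subst fun k _ => .simple k) = τ := by
  have h : (fun k (_ : Pos τ k) => Pd.simple k) = fun k p => (Sub.one τ).at p := by
    funext k p; exact (Sub.at_one τ k p).symm
  rw [h, Sub.subst_at, Sub.total_one]

theorem Pos.emb_one {n : ℕ} {τ : Pd n} (hf : IsShape fun k (_ : Pos τ k) => .simple k)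
    (h : (τ.subst fun k _ => .simple k) = τ) {k : ℕ} (p : Pos τ k) :
    emb hf h p (.top k) = p := by
  rw [(Sub.one τ).pos_emb' (fun k p => (Sub.at_one τ k p).symm) _ _ (Sub.total_one τ),
    Sub.emb_one, Pos.cast_cast]; rfl

/-- The globular set of shapes, i.e. the globular set of pasting diagrams in the terminal globular
set. -/
def shapes : GlobularSet.{0} where
  cell := Pd
  src := Pd.bdry
  tgt := Pd.bdry
  src_src := fun _ => rfl
  tgt_src := fun _ => rfl

/-- The source inclusion, as a morphism. -/
def Pd.inclS {n : ℕ} (τ : Pd (n + 1)) : GlobularSet.Hom τ.bdry.pos τ.pos :=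
  ⟨fun _ p => .inclS τ p, fun p => Pos.inclS_src τ _ p, fun p => Pos.inclS_tgt τ _ p⟩

/-- The target inclusion, as a morphism. -/
def Pd.inclT {n : ℕ} (τ : Pd (n + 1)) : GlobularSet.Hom τ.bdry.pos τ.pos :=
  ⟨fun _ p => .inclT τ p, fun p => Pos.inclT_src τ _ p, fun p => Pos.inclT_tgt τ _ p⟩

/-- An `n`-pasting diagram in a globular set `A`: a shape together with a labelling of its cells by
cells of `A` compatible with sources and targets. -/
structure Pasting (A : GlobularSet.{u}) (n : ℕ) : Type u where
  shape : Pd n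
  label : GlobularSet.Hom shape.pos A

/-- The underlying globular set `A*` of the free strict `ω`-category on `A`: its `n`-cells are the
`n`-pasting diagrams in `A`. -/
def GlobularSet.star (A : GlobularSet.{u}) : GlobularSet.{u} where
  cell := Pasting A
  src P := ⟨P.shape.bdry, P.shape.inclS.comp P.label⟩
  tgt P := ⟨P.shape.bdry, P.shape.inclT.comp P.label⟩
  src_src P := congrArg (Pasting.mk P.shape.bdry.bdry) (GlobularSet.Hom.ext (by
    funext k p; exact congrArg (P.label.map k) (Pos.inclS_inclS P.shape k p)))
  tgt_src P := congrArg (Pasting.mk P.shape.bdry.bdry) (GlobularSet.Hom.ext (by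
    funext k p; exact congrArg (P.label.map k) (Pos.inclS_inclT P.shape k p)))

theorem Pasting.ext_cast {A : GlobularSet.{u}} {n : ℕ} {P Q : Pasting A n} (h : P.shape = Q.shape)
    (hl : ∀ (k : ℕ) (p : Pos P.shape k), P.label.map k p = Q.label.map k (p.cast h)) : P = Q := by
  obtain ⟨τ, L⟩ := P
  obtain ⟨τ', L'⟩ := Q
  cases h
  congr 1
  ext k p
  exact hl k p

/-- The pasting diagram in `B` obtained by applying a morphism `A ⟶ B` to all labels. -/
def Pasting.map {A : GlobularSet.{u}} {B : GlobularSet.{v}} {n : ℕ} (f : GlobularSet.Hom A B)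
    (P : Pasting A n) : Pasting B n := ⟨P.shape, P.label.comp f⟩

/-- A globular collection: a globular set over the globular set of shapes. -/
structure Collection : Type (u + 1) where
  gset : GlobularSet.{u}
  shape : GlobularSet.Hom gset shapes

/-- The shapes of the labels of a pasting diagram in a collection. -/
def Collection.shapesOf (G : Collection.{u}) {n : ℕ} (P : Pasting G.gset n) (k : ℕ)
    (p : Pos P.shape k) : Pd k := G.shape.map k (P.label.map k p)

theorem Collection.isShape (G : Collection.{u}) {n : ℕ} (P : Pasting G.gset n) :
    IsShape (G.shapesOf P) := fun _ p =>
  ⟨(P.label.comp G.shape).map_src p, (P.label.comp G.shape).map_tgt p⟩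

/-- The shape obtained from a pasting diagram in a collection by replacing its cells by the shapes
of their labels. -/
def Collection.total (G : Collection.{u}) {n : ℕ} (P : Pasting G.gset n) : Pd n :=
  P.shape.subst (G.shapesOf P)

/-- The data of a globular operad: a collection `G` with morphisms of collections from the unit
collection (`ids`) and from the composite collection `G ∘ G` (`comp`).  An `n`-cell of `G ∘ G` is
an `n`-cell `x` of `G` with an `n`-pasting diagram `P` in `G` of shape `shape x`; the operadic
composite `comp x P` is written `x ∘ (x₁, …, xₘ)`, where the `xᵢ` are the labels of `P`. -/
structure PreOperad : Type (u + 1) extends Collection.{u} where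
  ids : ∀ n : ℕ, gset.cell n
  src_ids : ∀ n : ℕ, gset.src (ids (n + 1)) = ids n
  tgt_ids : ∀ n : ℕ, gset.tgt (ids (n + 1)) = ids n
  shape_ids : ∀ n : ℕ, shape.map n (ids n) = .simple n
  comp : ∀ {n : ℕ} (x : gset.cell n) (P : Pasting gset n), P.shape = shape.map n x → gset.cell n
  src_comp : ∀ {n : ℕ} (x : gset.cell (n + 1)) (P : Pasting gset (n + 1))
    (h : P.shape = shape.map (n + 1) x),
    gset.src (comp x P h) =
      comp (gset.src x) (gset.star.src P) ((congrArg Pd.bdry h).trans (shape.map_src x).symm)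
  tgt_comp : ∀ {n : ℕ} (x : gset.cell (n + 1)) (P : Pasting gset (n + 1))
    (h : P.shape = shape.map (n + 1) x),
    gset.tgt (comp x P h) =
      comp (gset.tgt x) (gset.star.tgt P) ((congrArg Pd.bdry h).trans (shape.map_tgt x).symm)
  shape_comp : ∀ {n : ℕ} (x : gset.cell n) (P : Pasting gset n) (h : P.shape = shape.map n x),
    shape.map n (comp x P h) = toCollection.total P

/-- The pasting diagram of the given shape all of whose labels are identities. -/
def PreOperad.idPasting (G : PreOperad.{u}) {n : ℕ} (τ : Pd n) : Pasting G.gset n :=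
  ⟨τ, fun k _ => G.ids k, fun _ => (G.src_ids _).symm, fun _ => (G.tgt_ids _).symm⟩

/-- If the shape of the pasting diagram `Q` is obtained by replacing the cells of `P` by the shapes
of their labels, then every cell `p` of `P` gives a piece of `Q`. -/
def Collection.piece (G : Collection.{u}) {n : ℕ} (P Q : Pasting G.gset n)
    (h : Q.shape = G.total P) {k : ℕ} (p : Pos P.shape k) : Pasting G.gset k where
  shape := G.shapesOf P k p
  label :=
    { map := fun m q => Q.label.map m (.emb (G.isShape P) h.symm p q)
      map_src := fun q =>
        (congrArg (Q.label.map _) (Pos.emb_src (G.isShape P) h.symm p q)).trans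
          (Q.label.map_src _)
      map_tgt := fun q =>
        (congrArg (Q.label.map _) (Pos.emb_tgt (G.isShape P) h.symm p q)).trans
          (Q.label.map_tgt _) }

theorem Collection.piece_src (G : Collection.{u}) {n : ℕ} (P Q : Pasting G.gset n)
    (h : Q.shape = G.total P) {k : ℕ} (p : Pos P.shape (k + 1)) :
    G.piece P Q h p.src = G.gset.star.src (G.piece P Q h p) :=
  Pasting.ext_cast (G.isShape P k p).1 fun _ q =>
    congrArg (Q.label.map _) (Pos.emb_src_eq (G.isShape P) h.symm p q (G.isShape P k p).1)

theorem Collection.piece_tgt (G : Collection.{u}) {n : ℕ} (P Q : Pasting G.gset n)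
    (h : Q.shape = G.total P) {k : ℕ} (p : Pos P.shape (k + 1)) :
    G.piece P Q h p.tgt = G.gset.star.tgt (G.piece P Q h p) :=
  Pasting.ext_cast (G.isShape P k p).2 fun _ q =>
    congrArg (Q.label.map _) (Pos.emb_tgt_eq (G.isShape P) h.symm p q (G.isShape P k p).2)

theorem PreOperad.comp_congr (G : PreOperad.{u}) {n : ℕ} {x x' : G.gset.cell n}
    {P P' : Pasting G.gset n} (hx : x = x') (hP : P = P') (h : P.shape = G.shape.map n x)
    (h' : P'.shape = G.shape.map n x') : G.comp x P h = G.comp x' P' h' := by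
  subst hx; subst hP; rfl

/-- The pasting diagram of the shape of `P` whose label at a cell `p` is the composite of the label
of `P` at `p` with the corresponding piece of `Q`. -/
def PreOperad.compPieces (G : PreOperad.{u}) {n : ℕ} (P Q : Pasting G.gset n)
    (h : Q.shape = G.total P) : Pasting G.gset n where
  shape := P.shape
  label :=
    { map := fun k p => G.comp (P.label.map k p) (G.piece P Q h p) rfl
      map_src := fun p => by
        refine Eq.trans ?_ (G.src_comp _ _ _).symm
        exact G.comp_congr (P.label.map_src p) (G.piece_src P Q h p) _ _
      map_tgt := fun p => by
        refine Eq.trans ?_ (G.tgt_comp _ _ _).symm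
        exact G.comp_congr (P.label.map_tgt p) (G.piece_tgt P Q h p) _ _ }

/-- A globular operad. -/
structure GlobularOperad : Type (u + 1) extends PreOperad.{u} where
  /-- Composing an identity with a simple pasting diagram gives its only label. -/
  id_comp : ∀ {n : ℕ} (L : GlobularSet.Hom (Pd.simple n).pos gset),
    comp (ids n) ⟨.simple n, L⟩ (shape_ids n).symm = L.map n (.top n)
  comp_id : ∀ {n : ℕ} (x : gset.cell n), comp x (toPreOperad.idPasting (shape.map n x)) rfl = x
  /-- Associativity: `(x ∘ P) ∘ Q = x ∘ (xᵢ ∘ Qᵢ)ᵢ`, where the `xᵢ` are the labels of `P` and the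
  `Qᵢ` are the corresponding pieces of `Q`. -/
  assoc : ∀ {n : ℕ} (x : gset.cell n) (P : Pasting gset n) (hP : P.shape = shape.map n x)
    (Q : Pasting gset n) (hQ : Q.shape = shape.map n (comp x P hP)),
    comp (comp x P hP) Q hQ =
      comp x (toPreOperad.compPieces P Q (hQ.trans (shape_comp x P hP))) hP

/-- A morphism of globular operads. -/
@[ext]
structure GlobularOperad.Hom (G : GlobularOperad.{u}) (H : GlobularOperad.{v}) : Type (max u v)
    extends toGSetHom : GlobularSet.Hom G.gset H.gset where
  map_shape : ∀ {n : ℕ} (x : G.gset.cell n), H.shape.map n (map n x) = G.shape.map n x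
  map_ids : ∀ n : ℕ, map n (G.ids n) = H.ids n
  map_comp : ∀ {n : ℕ} (x : G.gset.cell n) (P : Pasting G.gset n)
    (h : P.shape = G.shape.map n x),
    map n (G.comp x P h) = H.comp (map n x) (P.map toGSetHom) (h.trans (map_shape x).symm)

/-- A contraction function on a globular collection. -/
structure Contraction (G : Collection.{u}) : Type u where
  cell : ∀ {n : ℕ} (x y : G.gset.cell n) (τ : Pd (n + 1)), G.gset.Parallel x y →
    G.shape.map n x = τ.bdry → G.shape.map n y = τ.bdry → G.gset.cell (n + 1)
  src_cell : ∀ {n : ℕ} (x y : G.gset.cell n) (τ : Pd (n + 1)) (h : G.gset.Parallel x y)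
    (hx : G.shape.map n x = τ.bdry) (hy : G.shape.map n y = τ.bdry),
    G.gset.src (cell x y τ h hx hy) = x
  tgt_cell : ∀ {n : ℕ} (x y : G.gset.cell n) (τ : Pd (n + 1)) (h : G.gset.Parallel x y)
    (hx : G.shape.map n x = τ.bdry) (hy : G.shape.map n y = τ.bdry),
    G.gset.tgt (cell x y τ h hx hy) = y
  shape_cell : ∀ {n : ℕ} (x y : G.gset.cell n) (τ : Pd (n + 1)) (h : G.gset.Parallel x y)
    (hx : G.shape.map n x = τ.bdry) (hy : G.shape.map n y = τ.bdry),
    G.shape.map (n + 1) (cell x y τ h hx hy) = τ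

/-- A globular operad with a specified contraction. -/
structure CGOp : Type (u + 1) extends GlobularOperad.{u} where
  contraction : Contraction toCollection

theorem GlobularSet.Hom.map_parallel {A : GlobularSet.{u}} {B : GlobularSet.{v}}
    (f : GlobularSet.Hom A B) {n : ℕ} {x y : A.cell n} (h : A.Parallel x y) :
    B.Parallel (f.map n x) (f.map n y) := by
  cases n with
  | zero => exact trivial
  | succ n =>
    exact ⟨by rw [← f.map_src, ← f.map_src, h.1], by rw [← f.map_tgt, ← f.map_tgt, h.2]⟩

/-- A contraction preserving morphism of globular operads. -/
@[ext]
structure CGOp.Hom (G : CGOp.{u}) (H : CGOp.{v}) : Type (max u v)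
    extends toOperadHom : GlobularOperad.Hom G.toGlobularOperad H.toGlobularOperad where
  map_contraction : ∀ {n : ℕ} (x y : G.gset.cell n) (τ : Pd (n + 1)) (h : G.gset.Parallel x y)
    (hx : G.shape.map n x = τ.bdry) (hy : G.shape.map n y = τ.bdry),
    map (n + 1) (G.contraction.cell x y τ h hx hy) =
      H.contraction.cell (map n x) (map n y) τ (toGSetHom.map_parallel h)
        ((map_shape x).trans hx) ((map_shape y).trans hy)

theorem Contraction.cell_congr {G : Collection.{u}} (κ : Contraction G) {n : ℕ}
    {x x' y y' : G.gset.cell n} (ex : x = x') (ey : y = y') (τ : Pd (n + 1))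
    (h : G.gset.Parallel x y) (hx : G.shape.map n x = τ.bdry) (hy : G.shape.map n y = τ.bdry)
    (h' : G.gset.Parallel x' y') (hx' : G.shape.map n x' = τ.bdry)
    (hy' : G.shape.map n y' = τ.bdry) : κ.cell x y τ h hx hy = κ.cell x' y' τ h' hx' hy' := by
  subst ex; subst ey; rfl

/-- The category of globular operads with contraction. -/
instance : CategoryTheory.Category CGOp.{u} where
  Hom G H := CGOp.Hom G H
  id G :=
    { toGSetHom := GlobularSet.Hom.id G.gset
      map_shape := fun _ => rfl
      map_ids := fun _ => rfl
      map_comp := fun _ _ _ => rfl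
      map_contraction := fun _ _ _ _ _ _ => rfl }
  comp {G H K} f g :=
    { toGSetHom := f.toGSetHom.comp g.toGSetHom
      map_shape := fun x => (g.map_shape _).trans (f.map_shape x)
      map_ids := fun n => (congrArg (g.map n) (f.map_ids n)).trans (g.map_ids n)
      map_comp := fun x P h => (congrArg (g.map _) (f.map_comp x P h)).trans (g.map_comp _ _ _)
      map_contraction := fun x y τ h hx hy =>
        (congrArg (g.map _) (f.map_contraction x y τ h hx hy)).trans
          (g.map_contraction _ _ τ _ _ _) }

/-- Formal operadic composites of identities and generators.  The `n`-cells are the identity `id n`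
and, in positive dimension, the composites `χ ∘ (x₁, …, xₘ)`, where `χ : x ⟶ y` is the generator
given by `(x, y, τ)` and the `xᵢ` are the values of a family `R` indexed by the cells of `τ`. -/
inductive RawCell : ℕ → Type u
  | id (n : ℕ) : RawCell n
  | gen {n : ℕ} (x y : RawCell n) (τ : Pd (n + 1)) (R : ∀ k : ℕ, Pos τ k → RawCell k) :
      RawCell (n + 1)

/-- The shape of a formal composite. -/
def RawCell.shape : ∀ {n : ℕ}, RawCell.{u} n → Pd n
  | _, .id n => .simple n
  | _, .gen _ _ τ R => τ.subst fun k p => (R k p).shape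

open Classical in
/-- The part at a cell `p` of `τ` of a family indexed by the cells of `ρ = τ.subst f`.  (The values
`RawCell.id` for an incompatible family `f` are irrelevant.) -/
noncomputable def RawCell.part {n : ℕ} {τ : Pd n} (f : ∀ k : ℕ, Pos τ k → Pd k) {ρ : Pd n}
    (h : τ.subst f = ρ) (L : ∀ k : ℕ, Pos ρ k → RawCell.{u} k) {k : ℕ} (p : Pos τ k) (m : ℕ)
    (q : Pos (f k p) m) : RawCell.{u} m :=
  if hf : IsShape f then L m (.emb hf h p q) else .id m

/-- Composition of formal composites: `id ∘ (x) = x` and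
`(χ ∘ (x₁, …, xₘ)) ∘ (y₁, …) = χ ∘ (x₁ ∘ (y₁, …), …, xₘ ∘ (…))`. -/
noncomputable def RawCell.comp : ∀ {n : ℕ} (x : RawCell.{u} n) {ρ : Pd n}, x.shape = ρ →
    (∀ k : ℕ, Pos ρ k → RawCell.{u} k) → RawCell.{u} n
  | _, .id n, _, h, L => L n ((Pos.top n).cast h)
  | _, .gen x y τ R, _, h, L => .gen x y τ fun k p =>
      (R k p).comp rfl (part (fun k p => (R k p).shape) h L p)

open Classical in
/-- The source of a formal composite: the source of `id` is `id`, and the source of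
`χ ∘ (x₁, …, xₘ)`, with `χ : x ⟶ y`, is the composite of `x` with the source of the diagram
`(x₁, …, xₘ)`.  (The value for an ill-formed composite is irrelevant.) -/
noncomputable def RawCell.src : ∀ {n : ℕ}, RawCell.{u} (n + 1) → RawCell.{u} n
  | _, .id (n + 1) => .id n
  | _, .gen x _ τ R => if h : x.shape = τ.bdry then x.comp h fun k p => R k (.inclS τ p) else x

open Classical in
/-- The target of a formal composite. -/
noncomputable def RawCell.tgt : ∀ {n : ℕ}, RawCell.{u} (n + 1) → RawCell.{u} n
  | _, .id (n + 1) => .id n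
  | _, .gen _ y τ R => if h : y.shape = τ.bdry then y.comp h fun k p => R k (.inclT τ p) else y

/-- Formal composites with the same source and target (no condition in dimension `0`). -/
def RawCell.Parallel : ∀ {n : ℕ}, RawCell.{u} n → RawCell.{u} n → Prop
  | 0, _, _ => True
  | _ + 1, x, y => x.src = y.src ∧ x.tgt = y.tgt

/-- A family indexed by the cells of `τ` is compatible with sources and targets. -/
def RawCell.IsLabel {n : ℕ} {τ : Pd n} (R : ∀ k : ℕ, Pos τ k → RawCell.{u} k) : Prop :=
  ∀ (k : ℕ) (p : Pos τ (k + 1)), R k p.src = (R (k + 1) p).src ∧ R k p.tgt = (R (k + 1) p).tgt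

/-- Well-formed composites: the generators are those given by triples `(x, y, τ)`, where `x` and
`y` are parallel cells of shape `∂τ`, and they are composed with actual pasting diagrams. -/
inductive RawCell.WF : ∀ {n : ℕ}, RawCell.{u} n → Prop
  | id (n : ℕ) : WF (.id n)
  | gen {n : ℕ} {x y : RawCell.{u} n} {τ : Pd (n + 1)} {R : ∀ k : ℕ, Pos τ k → RawCell.{u} k}
      (hx : x.WF) (hy : y.WF) (hxy : x.Parallel y) (hxτ : x.shape = τ.bdry)
      (hyτ : y.shape = τ.bdry) (hR : ∀ k p, (R k p).WF) (hR' : IsLabel R) : WF (.gen x y τ R)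

theorem RawCell.comp_gen {n : ℕ} {x y : RawCell.{u} n} {τ : Pd (n + 1)}
    {R : ∀ k : ℕ, Pos τ k → RawCell.{u} k} (hR : IsShape fun k p => (R k p).shape)
    {ρ : Pd (n + 1)} (h : (RawCell.gen x y τ R).shape = ρ) (L : ∀ k : ℕ, Pos ρ k → RawCell.{u} k) :
    (RawCell.gen x y τ R).comp h L =
      .gen x y τ fun _ p => (R _ p).comp rfl fun m q => L m (.emb hR h p q) := by
  rw [comp]
  congr 1
  funext k p
  congr 1
  funext m q
  exact dif_pos hR

theorem RawCell.src_gen {n : ℕ} {x y : RawCell.{u} n} {τ : Pd (n + 1)}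
    {R : ∀ k : ℕ, Pos τ k → RawCell.{u} k} (h : x.shape = τ.bdry) :
    (RawCell.gen x y τ R).src = x.comp h fun k p => R k (.inclS τ p) := dif_pos h

theorem RawCell.tgt_gen {n : ℕ} {x y : RawCell.{u} n} {τ : Pd (n + 1)}
    {R : ∀ k : ℕ, Pos τ k → RawCell.{u} k} (h : y.shape = τ.bdry) :
    (RawCell.gen x y τ R).tgt = y.comp h fun k p => R k (.inclT τ p) := dif_pos h

theorem RawCell.comp_congr {n : ℕ} {x x' : RawCell.{u} n} (e : x = x') {ρ : Pd n}
    (h : x.shape = ρ) (h' : x'.shape = ρ) {L L' : ∀ k : ℕ, Pos ρ k → RawCell.{u} k} (eL : L = L') :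
    x.comp h L = x'.comp h' L' := by
  subst e; subst eL; rfl

/-- Labels of a formal composite satisfy this hereditarily; it is all that is needed to compute
shapes and composites. -/
inductive RawCell.Good : ∀ {n : ℕ}, RawCell.{u} n → Prop
  | id (n : ℕ) : Good (.id n)
  | gen {n : ℕ} {x y : RawCell.{u} n} {τ : Pd (n + 1)} {R : ∀ k : ℕ, Pos τ k → RawCell.{u} k}
      (hx : x.Good) (hy : y.Good) (hR : ∀ k p, (R k p).Good)
      (hR' : IsShape fun k p => (R k p).shape) : Good (.gen x y τ R)

theorem Pos.emb_emb' {n : ℕ} {τ : Pd n} {f : ∀ k : ℕ, Pos τ k → Pd k} (hf : IsShape f) {ρ : Pd n}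
    (h : τ.subst f = ρ) {g : ∀ k : ℕ, Pos ρ k → Pd k} (hg : IsShape g) {χ : Pd n}
    (hχ : ρ.subst g = χ) {f₁ : ∀ k : ℕ, Pos τ k → Pd k} (hf₁ : IsShape f₁) (h₁ : τ.subst f₁ = χ)
    (e : ∀ (k : ℕ) (p : Pos τ k), ((f k p).subst fun m q => g m (.emb hf h p q)) = f₁ k p)
    {k : ℕ} (p : Pos τ k) (hg₁ : IsShape fun m q => g m (.emb hf h p q))
    {m : ℕ} (q : Pos (f k p) m) {l : ℕ} (r : Pos (g m (.emb hf h p q)) l) :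
    emb hf₁ h₁ p (emb hg₁ (e k p) q r) = emb hg hχ (emb hf h p q) r := by
  obtain rfl : (fun k p => (f k p).subst fun m q => g m (.emb hf h p q)) = f₁ := by
    funext k p; exact e k p
  exact Pos.emb_emb hf h hg hχ hf₁ h₁ p hg₁ q r

theorem RawCell.shape_comp {n : ℕ} {x : RawCell.{u} n} (hx : x.Good) {ρ : Pd n}
    (h : x.shape = ρ) {L : ∀ k : ℕ, Pos ρ k → RawCell.{u} k}
    (hL : IsShape fun k p => (L k p).shape) :
    (x.comp h L).shape = ρ.subst fun k p => (L k p).shape := by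
  induction hx with
  | id n => subst h; exact (Pd.subst_simple hL).symm
  | gen hx hy hR hR' _ _ ih =>
    rw [comp_gen hR']
    refine Eq.trans ?_ (Pd.subst_subst hR' h hL)
    rw [shape]
    congr 1
    funext k p
    exact ih k p rfl (IsShape.emb hR' h hL p)

theorem RawCell.comp_comp {n : ℕ} {x : RawCell.{u} n} (hx : x.Good) {ρ : Pd n}
    (h : x.shape = ρ) {L : ∀ k : ℕ, Pos ρ k → RawCell.{u} k}
    (hL : IsShape fun k p => (L k p).shape) {χ : Pd n} (h' : (x.comp h L).shape = χ)
    (h'' : (ρ.subst fun k p => (L k p).shape) = χ)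
    {M : ∀ k : ℕ, Pos χ k → RawCell.{u} k} (hM : IsShape fun k p => (M k p).shape) :
    (x.comp h L).comp h' M =
      x.comp h fun _ p => (L _ p).comp rfl fun m q => M m (.emb hL h'' p q) := by
  induction hx with
  | id n =>
    subst h
    have e : (L n ((Pos.top n).cast rfl)).shape = χ := h'
    have : ∀ {ξ : Pd n} (e : (L n (Pos.top n)).shape = ξ) (M : ∀ k : ℕ, Pos ξ k → RawCell.{u} k),
        (L n (Pos.top n)).comp e M = (L n (Pos.top n)).comp rfl fun m q => M m (q.cast e) := by
      intro ξ e M; subst e; rfl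
    refine (this e M).trans ?_
    refine comp_congr rfl _ _ ?_
    funext m q
    exact congrArg (M m) (Pos.emb_top hL h'' q e).symm
  | @gen n x y τ R hx hy hR hR' _ _ ih =>
    have e1 : ∀ (k : ℕ) (p : Pos τ k),
        ((R k p).shape.subst fun m q => (L m (.emb hR' h p q)).shape) =
          ((R k p).comp rfl fun m q => L m (.emb hR' h p q)).shape := fun k p =>
      (shape_comp (hR k p) rfl (IsShape.emb hR' h hL p)).symm
    have key : IsShape fun k p => ((R k p).comp rfl fun m q => L m (.emb hR' h p q)).shape := by
      simp only [← e1]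
      exact IsShape.subst hR' h hL
    have h1 : (RawCell.gen x y τ fun k p =>
        (R k p).comp rfl fun m q => L m (.emb hR' h p q)).shape = χ := by
      rw [← comp_gen hR']; exact h'
    rw [comp_congr (comp_gen hR' h L) h' h1 (rfl : M = M), comp_gen key, comp_gen hR']
    congr 1
    funext k p
    refine (ih k p rfl (IsShape.emb hR' h hL p) rfl (e1 k p) (IsShape.emb key h1 hM p)).trans ?_
    refine comp_congr rfl _ _ ?_
    funext m q
    refine comp_congr rfl _ _ ?_
    funext l r
    exact congrArg (M l) (Pos.emb_emb' hR' h hL h'' key h1 e1 p _ q r)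

theorem RawCell.comp_id {n : ℕ} {x : RawCell.{u} n} (hx : x.Good) :
    x.comp rfl (fun k _ => .id k) = x := by
  induction hx with
  | id n => rfl
  | gen hx hy hR hR' _ _ ih =>
    rw [comp_gen hR']
    congr 1
    funext k p
    exact ih k p

/-- A well-formed composite satisfies all that is needed to compute with it. -/
theorem RawCell.WF.good_and {n : ℕ} {x : RawCell.{u} n} (hx : x.WF) :
    x.Good ∧ ∀ (m : ℕ) (e : n = m + 1),
      (e ▸ x : RawCell.{u} (m + 1)).src.shape = (e ▸ x : RawCell.{u} (m + 1)).shape.bdry ∧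
      (e ▸ x : RawCell.{u} (m + 1)).tgt.shape = (e ▸ x : RawCell.{u} (m + 1)).shape.bdry := by
  induction hx with
  | id n =>
    refine ⟨.id n, fun m e => ?_⟩
    subst e
    exact ⟨(Pd.bdry_simple m).symm, (Pd.bdry_simple m).symm⟩
  | @gen n x y τ R hx hy hxy hxτ hyτ hR hR' ihx ihy ih =>
    have hS : IsShape fun k p => (R k p).shape := fun k p => by
      have := (ih (k + 1) p).2 k rfl
      dsimp only
      rw [(hR' k p).1, (hR' k p).2]
      exact this
    refine ⟨.gen ihx.1 ihy.1 (fun k p => (ih k p).1) hS, fun m e => ?_⟩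
    cases e
    refine ⟨?_, ?_⟩
    · change (RawCell.src (.gen _ _ _ _)).shape = _
      rw [src_gen hxτ, shape_comp ihx.1 _ hS.inclS]
      exact Pd.subst_inclS hS
    · change (RawCell.tgt (.gen _ _ _ _)).shape = _
      rw [tgt_gen hyτ, shape_comp ihy.1 _ hS.inclT]
      exact Pd.subst_inclT hS

theorem RawCell.WF.good {n : ℕ} {x : RawCell.{u} n} (hx : x.WF) : x.Good := hx.good_and.1

theorem RawCell.WF.shape_src {n : ℕ} {x : RawCell.{u} (n + 1)} (hx : x.WF) :
    x.src.shape = x.shape.bdry := (hx.good_and.2 n rfl).1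

theorem RawCell.WF.shape_tgt {n : ℕ} {x : RawCell.{u} (n + 1)} (hx : x.WF) :
    x.tgt.shape = x.shape.bdry := (hx.good_and.2 n rfl).2

theorem RawCell.IsLabel.isShape {n : ℕ} {τ : Pd n} {R : ∀ k : ℕ, Pos τ k → RawCell.{u} k}
    (h : IsLabel R) (hR : ∀ k p, (R k p).WF) : IsShape fun k p => (R k p).shape := fun k p => by
  dsimp only
  rw [(h k p).1, (h k p).2]
  exact ⟨(hR _ p).shape_src, (hR _ p).shape_tgt⟩

theorem RawCell.IsLabel.inclS {n : ℕ} {τ : Pd (n + 1)} {R : ∀ k : ℕ, Pos τ k → RawCell.{u} k}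
    (h : IsLabel R) : IsLabel fun k p => R k (.inclS τ p) := fun k p => by
  dsimp only; rw [Pos.inclS_src, Pos.inclS_tgt]; exact h k _

theorem RawCell.IsLabel.inclT {n : ℕ} {τ : Pd (n + 1)} {R : ∀ k : ℕ, Pos τ k → RawCell.{u} k}
    (h : IsLabel R) : IsLabel fun k p => R k (.inclT τ p) := fun k p => by
  dsimp only; rw [Pos.inclT_src, Pos.inclT_tgt]; exact h k _

theorem RawCell.IsLabel.emb {n : ℕ} {τ : Pd n} {f : ∀ k : ℕ, Pos τ k → Pd k} (hf : IsShape f)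
    {ρ : Pd n} (h : τ.subst f = ρ) {L : ∀ k : ℕ, Pos ρ k → RawCell.{u} k} (hL : IsLabel L)
    {k : ℕ} (p : Pos τ k) : IsLabel fun m q => L m (.emb hf h p q) := fun m q => by
  dsimp only; rw [Pos.emb_src, Pos.emb_tgt]; exact hL m _

theorem RawCell.src_comp {n : ℕ} {x : RawCell.{u} (n + 1)} (hx : x.WF) {ρ : Pd (n + 1)}
    (h : x.shape = ρ) {L : ∀ k : ℕ, Pos ρ k → RawCell.{u} k} (hL : IsLabel L)
    (hL' : ∀ k p, (L k p).WF) (h' : x.src.shape = ρ.bdry) :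
    (x.comp h L).src = x.src.comp h' fun k p => L k (.inclS ρ p) := by
  cases hx with
  | id =>
    subst h
    refine ((hL _ (.top (n + 1))).1).symm.trans ?_
    exact congrArg (L n) (Pos.inclS_top n).symm
  | @gen _ x y τ R hx hy hxy hxτ hyτ hR hR' =>
    have hS := hR'.isShape hR
    have hLS := hL.isShape hL'
    have h1 : (τ.bdry.subst fun k p => (R k (.inclS τ p)).shape) = ρ.bdry :=
      (Pd.subst_inclS hS).trans (congrArg Pd.bdry h)
    rw [comp_gen hS, src_gen hxτ, comp_congr (src_gen hxτ) h' _ rfl,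
      comp_comp hx.good hxτ hS.inclS _ h1 hLS.inclS]
    · refine comp_congr rfl _ _ ?_
      funext k p
      refine comp_congr rfl _ _ ?_
      funext m q
      exact congrArg (L m) (Pos.inclS_emb hS h hS.inclS h1 p q).symm
    · rwa [← src_gen hxτ]

theorem RawCell.tgt_comp {n : ℕ} {x : RawCell.{u} (n + 1)} (hx : x.WF) {ρ : Pd (n + 1)}
    (h : x.shape = ρ) {L : ∀ k : ℕ, Pos ρ k → RawCell.{u} k} (hL : IsLabel L)
    (hL' : ∀ k p, (L k p).WF) (h' : x.tgt.shape = ρ.bdry) :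
    (x.comp h L).tgt = x.tgt.comp h' fun k p => L k (.inclT ρ p) := by
  cases hx with
  | id =>
    subst h
    refine ((hL _ (.top (n + 1))).2).symm.trans ?_
    exact congrArg (L n) (Pos.inclT_top n).symm
  | @gen _ x y τ R hx hy hxy hxτ hyτ hR hR' =>
    have hS := hR'.isShape hR
    have hLS := hL.isShape hL'
    have h1 : (τ.bdry.subst fun k p => (R k (.inclT τ p)).shape) = ρ.bdry :=
      (Pd.subst_inclT hS).trans (congrArg Pd.bdry h)
    rw [comp_gen hS, tgt_gen hyτ, comp_congr (tgt_gen hyτ) h' _ rfl,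
      comp_comp hy.good hyτ hS.inclT _ h1 hLS.inclT]
    · refine comp_congr rfl _ _ ?_
      funext k p
      refine comp_congr rfl _ _ ?_
      funext m q
      exact congrArg (L m) (Pos.inclT_emb hS h hS.inclT h1 p q).symm
    · rwa [← tgt_gen hyτ]

theorem RawCell.comp_cast {n : ℕ} {x x' : RawCell.{u} n} (e : x = x') {ρ ρ' : Pd n}
    (h : x.shape = ρ) (h' : x'.shape = ρ') (hρ : ρ = ρ') {L : ∀ k : ℕ, Pos ρ k → RawCell.{u} k}
    {L' : ∀ k : ℕ, Pos ρ' k → RawCell.{u} k} (eL : ∀ k p, L k p = L' k (p.cast hρ)) :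
    x.comp h L = x'.comp h' L' := by
  subst hρ; exact comp_congr e _ _ (by funext k p; exact eL k p)

theorem RawCell.isLabel_comp {n : ℕ} {τ : Pd n} {R : ∀ k : ℕ, Pos τ k → RawCell.{u} k}
    (hR : ∀ k p, (R k p).WF) (hR' : IsLabel R) (hS : IsShape fun k p => (R k p).shape) {ρ : Pd n}
    (h : (τ.subst fun k p => (R k p).shape) = ρ) {L : ∀ k : ℕ, Pos ρ k → RawCell.{u} k}
    (hL : IsLabel L) (hL' : ∀ k p, (L k p).WF) :
    IsLabel fun _ p => (R _ p).comp rfl fun m q => L m (.emb hS h p q) := fun k p => by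
  dsimp only
  constructor
  · rw [src_comp (hR _ p) rfl (hL.emb hS h p) (fun m q => hL' m _) (hR _ p).shape_src]
    exact comp_cast (hR' k p).1 _ _ (hS k p).1
      fun m q => congrArg (L m) (Pos.emb_src_eq hS h p q (hS k p).1)
  · rw [tgt_comp (hR _ p) rfl (hL.emb hS h p) (fun m q => hL' m _) (hR _ p).shape_tgt]
    exact comp_cast (hR' k p).2 _ _ (hS k p).2
      fun m q => congrArg (L m) (Pos.emb_tgt_eq hS h p q (hS k p).2)

theorem RawCell.WF.comp {n : ℕ} {x : RawCell.{u} n} (hx : x.WF) {ρ : Pd n}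
    (h : x.shape = ρ) {L : ∀ k : ℕ, Pos ρ k → RawCell.{u} k} (hL : IsLabel L)
    (hL' : ∀ k p, (L k p).WF) : (x.comp h L).WF := by
  induction hx with
  | id n => exact hL' n _
  | @gen n x y τ R hx hy hxy hxτ hyτ hR hR' _ _ ih =>
    have hS := hR'.isShape hR
    rw [comp_gen hS]
    exact .gen hx hy hxy hxτ hyτ (fun k p => ih k p rfl (hL.emb hS h p) fun m q => hL' m _)
      (isLabel_comp hR hR' hS h hL hL')

theorem RawCell.WF.src {n : ℕ} {x : RawCell.{u} (n + 1)} (hx : x.WF) : x.src.WF := by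
  cases hx with
  | id => exact .id n
  | gen hx hy hxy hxτ hyτ hR hR' =>
    rw [src_gen hxτ]; exact hx.comp _ hR'.inclS fun k p => hR k _

theorem RawCell.WF.tgt {n : ℕ} {x : RawCell.{u} (n + 1)} (hx : x.WF) : x.tgt.WF := by
  cases hx with
  | id => exact .id n
  | gen hx hy hxy hxτ hyτ hR hR' =>
    rw [tgt_gen hyτ]; exact hy.comp _ hR'.inclT fun k p => hR k _

theorem RawCell.WF.src_src {n : ℕ} {x : RawCell.{u} (n + 2)} (hx : x.WF) :
    x.src.src = x.tgt.src := by
  cases hx with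
  | id => rfl
  | @gen _ x y τ R hx hy hxy hxτ hyτ hR hR' =>
    rw [src_gen hxτ, tgt_gen hyτ,
      src_comp hx hxτ hR'.inclS (fun k p => hR k _) (hx.shape_src.trans (congrArg Pd.bdry hxτ)),
      src_comp hy hyτ hR'.inclT (fun k p => hR k _) (hy.shape_src.trans (congrArg Pd.bdry hyτ))]
    refine comp_congr hxy.1 _ _ ?_
    funext k p
    exact congrArg (R k) (Pos.inclS_inclS τ k p)

theorem RawCell.WF.tgt_src {n : ℕ} {x : RawCell.{u} (n + 2)} (hx : x.WF) :
    x.src.tgt = x.tgt.tgt := by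
  cases hx with
  | id => rfl
  | @gen _ x y τ R hx hy hxy hxτ hyτ hR hR' =>
    rw [src_gen hxτ, tgt_gen hyτ,
      tgt_comp hx hxτ hR'.inclS (fun k p => hR k _) (hx.shape_tgt.trans (congrArg Pd.bdry hxτ)),
      tgt_comp hy hyτ hR'.inclT (fun k p => hR k _) (hy.shape_tgt.trans (congrArg Pd.bdry hyτ))]
    refine comp_congr hxy.2 _ _ ?_
    funext k p
    exact congrArg (R k) (Pos.inclS_inclT τ k p)

/-- The globular set underlying the operad `I`: well-formed formal composites. -/
noncomputable def I.gset : GlobularSet.{u} where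
  cell n := { x : RawCell.{u} n // x.WF }
  src x := ⟨x.1.src, x.2.src⟩
  tgt x := ⟨x.1.tgt, x.2.tgt⟩
  src_src x := Subtype.ext x.2.src_src
  tgt_src x := Subtype.ext x.2.tgt_src

/-- The globular collection underlying the operad `I`. -/
noncomputable def I.collection : Collection.{u} where
  gset := I.gset
  shape :=
    { map := fun _ x => x.1.shape
      map_src := fun x => x.2.shape_src
      map_tgt := fun x => x.2.shape_tgt }

/-- The labels of a pasting diagram of formal composites. -/
def I.raw {n : ℕ} (P : Pasting I.gset.{u} n) (k : ℕ) (p : Pos P.shape k) : RawCell.{u} k :=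
  (P.label.map k p).1

theorem I.isLabel {n : ℕ} (P : Pasting I.gset.{u} n) : RawCell.IsLabel (I.raw P) := fun _ p =>
  ⟨congrArg Subtype.val (P.label.map_src p), congrArg Subtype.val (P.label.map_tgt p)⟩

theorem I.wf {n : ℕ} (P : Pasting I.gset.{u} n) (k : ℕ) (p : Pos P.shape k) : (I.raw P k p).WF :=
  (P.label.map k p).2

/-- The data of the operad `I`. -/
noncomputable def I.preOperad : PreOperad.{u} where
  toCollection := I.collection
  ids n := ⟨.id n, .id n⟩
  src_ids _ := rfl
  tgt_ids _ := rfl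
  shape_ids _ := rfl
  comp x P h := ⟨x.1.comp h.symm (I.raw P), x.2.comp _ (I.isLabel P) (I.wf P)⟩
  src_comp x P h := Subtype.ext (RawCell.src_comp x.2 h.symm (I.isLabel P) (I.wf P) _)
  tgt_comp x P h := Subtype.ext (RawCell.tgt_comp x.2 h.symm (I.isLabel P) (I.wf P) _)
  shape_comp x P h := RawCell.shape_comp x.2.good h.symm ((I.isLabel P).isShape (I.wf P))

/-- The globular operad `I`. -/
noncomputable def I.operad : GlobularOperad.{u} where
  toPreOperad := I.preOperad
  id_comp _ := rfl
  comp_id x := Subtype.ext (RawCell.comp_id x.2.good)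
  assoc x P hP Q hQ := Subtype.ext (RawCell.comp_comp x.2.good hP.symm
    ((I.isLabel P).isShape (I.wf P)) hQ.symm _ ((I.isLabel Q).isShape (I.wf Q)))

/-- The generator of `I` given by the triple `(x, y, τ)`, i.e. the composite `χ ∘ (id, …, id)`. -/
def I.generator {n : ℕ} (x y : I.gset.{u}.cell n) (τ : Pd (n + 1)) (h : I.gset.Parallel x y)
    (hx : x.1.shape = τ.bdry) (hy : y.1.shape = τ.bdry) : I.gset.{u}.cell (n + 1) :=
  ⟨.gen x.1 y.1 τ fun k _ => .id k, .gen x.2 y.2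
    (match n, x, y, h with
      | 0, _, _, _ => trivial
      | _ + 1, _, _, h => ⟨congrArg Subtype.val h.1, congrArg Subtype.val h.2⟩)
    hx hy (fun k _ => .id k) (fun _ _ => ⟨rfl, rfl⟩)⟩

/-- The canonical contraction on `I`, given by the generators. -/
noncomputable def I.contraction : Contraction I.collection.{u} where
  cell := I.generator
  src_cell x y τ h hx hy := Subtype.ext (by
    change (RawCell.gen x.1 y.1 τ fun k _ => .id k).src = x.1
    rw [RawCell.src_gen hx]
    exact (RawCell.comp_cast rfl _ rfl hx.symm fun _ _ => rfl).trans (RawCell.comp_id x.2.good))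
  tgt_cell x y τ h hx hy := Subtype.ext (by
    change (RawCell.gen x.1 y.1 τ fun k _ => .id k).tgt = y.1
    rw [RawCell.tgt_gen hy]
    exact (RawCell.comp_cast rfl _ rfl hy.symm fun _ _ => rfl).trans (RawCell.comp_id y.2.good))
  shape_cell x y τ h hx hy := Pd.subst_one τ

/-- The globular operad `I` freely generated by one cell `χ : x ⟶ y` of shape `τ` for every triple
`(x, y, τ)` of parallel cells `x`, `y` and a shape `τ` with boundary the shape of `x` and of `y`,
equipped with its canonical contraction. -/
noncomputable def I : CGOp.{u} where
  toGlobularOperad := I.operad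
  contraction := I.contraction

/-- The only `0`-cell of `I` is the identity. -/
theorem I.cell_zero (x : I.{u}.gset.cell 0) : x = I.{u}.ids 0 := by
  obtain ⟨x, hx⟩ := x
  cases x
  rfl

/-- Every cell of `I` of positive dimension is an identity, or is obtained from a generator by
composition with a pasting diagram. -/
theorem I.cell_succ {n : ℕ} (z : I.{u}.gset.cell (n + 1)) : z = I.{u}.ids (n + 1) ∨
    ∃ (x y : I.{u}.gset.cell n) (τ : Pd (n + 1)) (h : I.{u}.gset.Parallel x y)
      (hx : I.{u}.shape.map n x = τ.bdry) (hy : I.{u}.shape.map n y = τ.bdry)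
      (P : Pasting I.{u}.gset (n + 1))
      (hP : P.shape = I.{u}.shape.map (n + 1) (I.{u}.contraction.cell x y τ h hx hy)),
      z = I.{u}.comp (I.{u}.contraction.cell x y τ h hx hy) P hP := by
  obtain ⟨z, hz⟩ := z
  cases hz with
  | id => exact .inl rfl
  | @gen _ x y τ R hx hy hxy hxτ hyτ hR hR' =>
    have h : I.{u}.gset.Parallel ⟨x, hx⟩ ⟨y, hy⟩ := by
      cases n with
      | zero => trivial
      | succ n => exact ⟨Subtype.ext hxy.1, Subtype.ext hxy.2⟩
    have e : (RawCell.gen x y τ fun k _ => .id k).shape = τ := Pd.subst_one τ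
    refine .inr ⟨⟨x, hx⟩, ⟨y, hy⟩, τ, h, hxτ, hyτ,
      ⟨τ, fun k p => ⟨R k p, hR k p⟩, fun p => Subtype.ext (hR' _ p).1,
        fun p => Subtype.ext (hR' _ p).2⟩, e.symm, Subtype.ext ?_⟩
    have hS : IsShape fun k (_ : Pos τ k) => (RawCell.id.{u} k).shape := isShape_simple τ
    refine Eq.trans ?_ (RawCell.comp_gen hS e R).symm
    refine congrArg (RawCell.gen x y τ) ?_
    funext k p
    exact congrArg (R k) (Pos.emb_one (isShape_simple τ) (Pd.subst_one τ) p).symm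

end Globular

namespace Globular

open Classical in
/-- The composite in `H` of the contraction cell of `(a, b, τ)` with the family `L`.  (The value for
incompatible data is irrelevant.) -/
noncomputable def CGOp.contractComp (H : CGOp.{v}) {n : ℕ} (a b : H.gset.cell n) (τ : Pd (n + 1))
    (L : ∀ k : ℕ, Pos τ k → H.gset.cell k) : H.gset.cell (n + 1) :=
  if h : (H.gset.Parallel a b ∧ H.shape.map n a = τ.bdry ∧ H.shape.map n b = τ.bdry) ∧
      ∃ M : GlobularSet.Hom τ.pos H.gset, M.map = L then
    H.comp (H.contraction.cell a b τ h.1.1 h.1.2.1 h.1.2.2) ⟨τ, h.2.choose⟩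
      (H.contraction.shape_cell a b τ h.1.1 h.1.2.1 h.1.2.2).symm
  else H.ids (n + 1)

theorem CGOp.contractComp_eq (H : CGOp.{v}) {n : ℕ} {a b : H.gset.cell n} {τ : Pd (n + 1)}
    (hab : H.gset.Parallel a b) (ha : H.shape.map n a = τ.bdry) (hb : H.shape.map n b = τ.bdry)
    {L : ∀ k : ℕ, Pos τ k → H.gset.cell k} (M : GlobularSet.Hom τ.pos H.gset)
    (hM : ∀ k p, L k p = M.map k p) :
    H.contractComp a b τ L = H.comp (H.contraction.cell a b τ hab ha hb) ⟨τ, M⟩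
      (H.contraction.shape_cell a b τ hab ha hb).symm := by
  have hM' : M.map = L := by
    funext k p
    exact (hM k p).symm
  have h : ∃ M : GlobularSet.Hom τ.pos H.gset, M.map = L := ⟨M, hM'⟩
  have e : h.choose = M := GlobularSet.Hom.ext (h.choose_spec.trans hM'.symm)
  exact (dif_pos ⟨⟨hab, ha, hb⟩, h⟩).trans
    (H.comp_congr rfl (congrArg (Pasting.mk τ) e) _ _)

/-- The value of a formal composite in a globular operad with contraction. -/
noncomputable def RawCell.eval (H : CGOp.{v}) : ∀ {n : ℕ}, RawCell.{u} n → H.gset.cell n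
  | _, .id n => H.ids n
  | _, .gen x y τ R => H.contractComp (x.eval H) (y.eval H) τ fun k p => (R k p).eval H

/-- The properties of the value of a formal composite that are proved simultaneously. -/
structure RawCell.EvalSpec (H : CGOp.{v}) {n : ℕ} (x : RawCell.{u} n) : Prop where
  shape : H.shape.map n (x.eval H) = x.shape
  src : ∀ (m : ℕ) (e : n = m + 1), H.gset.src ((e ▸ x : RawCell.{u} (m + 1)).eval H) =
    (e ▸ x : RawCell.{u} (m + 1)).src.eval H
  tgt : ∀ (m : ℕ) (e : n = m + 1), H.gset.tgt ((e ▸ x : RawCell.{u} (m + 1)).eval H) =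
    (e ▸ x : RawCell.{u} (m + 1)).tgt.eval H
  comp : ∀ (Q : Pasting H.gset n) (hQ : x.shape = Q.shape)
    (L : ∀ k : ℕ, Pos Q.shape k → RawCell.{u} k) (_ : ∀ k p, (L k p).eval H = Q.label.map k p),
    (x.comp hQ L).eval H = H.comp (x.eval H) Q (hQ.symm.trans shape.symm)

theorem RawCell.EvalSpec.parallel {H : CGOp.{v}} {n : ℕ} {x y : RawCell.{u} n}
    (hx : x.EvalSpec H) (hy : y.EvalSpec H) (h : x.Parallel y) :
    H.gset.Parallel (x.eval H) (y.eval H) := by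
  cases n with
  | zero => trivial
  | succ n =>
    exact ⟨(hx.src n rfl).trans ((congrArg (eval H) h.1).trans (hy.src n rfl).symm),
      (hx.tgt n rfl).trans ((congrArg (eval H) h.2).trans (hy.tgt n rfl).symm)⟩

/-- The values of a compatible family, as a labelling. -/
noncomputable def RawCell.evalLabel {H : CGOp.{v}} {n : ℕ} {τ : Pd n}
    {R : ∀ k : ℕ, Pos τ k → RawCell.{u} k} (hR : ∀ k p, (R k p).EvalSpec H) (hR' : IsLabel R) :
    GlobularSet.Hom τ.pos H.gset where
  map k p := (R k p).eval H
  map_src p := (congrArg (eval H) (hR' _ p).1).trans ((hR _ p).src _ rfl).symm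
  map_tgt p := (congrArg (eval H) (hR' _ p).2).trans ((hR _ p).tgt _ rfl).symm

theorem Pos.emb_congr {n : ℕ} {τ : Pd n} {f f' : ∀ k : ℕ, Pos τ k → Pd k} (hf : IsShape f)
    (hf' : IsShape f') (e : ∀ k p, f k p = f' k p) {ρ : Pd n} (h : τ.subst f = ρ)
    (h' : τ.subst f' = ρ) {k : ℕ} (p : Pos τ k) {m : ℕ} (q : Pos (f k p) m) :
    emb hf h p q = emb hf' h' p (q.cast (e k p)) := by
  obtain rfl : f = f' := by
    funext k p
    exact e k p
  rfl

theorem RawCell.comp_cast_shape {n : ℕ} {x : RawCell.{u} n} {ρ : Pd n} (h : x.shape = ρ)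
    (L : ∀ k : ℕ, Pos x.shape k → RawCell.{u} k) :
    x.comp rfl L = x.comp h fun k p => L k (p.cast h.symm) := by
  subst h
  rfl

theorem RawCell.WF.evalSpec (H : CGOp.{v}) {n : ℕ} {x : RawCell.{u} n} (hx : x.WF) :
    x.EvalSpec H := by
  induction hx with
  | id n =>
    refine ⟨H.shape_ids n, fun m e => ?_, fun m e => ?_, fun Q hQ L hL => ?_⟩
    · subst e
      exact H.src_ids m
    · subst e
      exact H.tgt_ids m
    · obtain ⟨τ, M⟩ := Q
      cases hQ
      exact (hL _ _).trans (H.id_comp M).symm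
  | @gen n x y τ R hx hy hxy hxτ hyτ hR hR' ihx ihy ih =>
    have hS := hR'.isShape hR
    have hab := ihx.parallel ihy hxy
    have ha := ihx.shape.trans hxτ
    have hb := ihy.shape.trans hyτ
    have hgen : (RawCell.gen x y τ R).eval H = _ :=
      H.contractComp_eq hab ha hb (evalLabel ih hR') fun _ _ => rfl
    have hshapes : (fun k p => H.shape.map k ((R k p).eval H)) = fun k p => (R k p).shape := by
      funext k p
      exact (ih k p).shape
    have hshape : H.shape.map (n + 1) ((RawCell.gen x y τ R).eval H) =
        (RawCell.gen x y τ R).shape :=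
      (congrArg (H.shape.map (n + 1)) hgen).trans
        ((H.shape_comp _ _ _).trans (congrArg τ.subst hshapes))
    refine ⟨hshape, fun m e => ?_, fun m e => ?_, fun Q hQ L hL => ?_⟩
    · cases e
      change H.gset.src ((RawCell.gen x y τ R).eval H) = (RawCell.gen x y τ R).src.eval H
      rw [src_gen hxτ]
      refine ((congrArg H.gset.src hgen).trans (H.src_comp _ _ _)).trans ?_
      refine Eq.trans ?_ (ihx.comp (H.gset.star.src ⟨τ, evalLabel ih hR'⟩) hxτ _
        fun _ _ => rfl).symm
      exact H.comp_congr (H.contraction.src_cell _ _ τ hab ha hb) rfl _ _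
    · cases e
      change H.gset.tgt ((RawCell.gen x y τ R).eval H) = (RawCell.gen x y τ R).tgt.eval H
      rw [tgt_gen hyτ]
      refine ((congrArg H.gset.tgt hgen).trans (H.tgt_comp _ _ _)).trans ?_
      refine Eq.trans ?_ (ihy.comp (H.gset.star.tgt ⟨τ, evalLabel ih hR'⟩) hyτ _
        fun _ _ => rfl).symm
      exact H.comp_congr (H.contraction.tgt_cell _ _ τ hab ha hb) rfl _ _
    · have hQ' : Q.shape = H.shape.map (n + 1) (H.comp (H.contraction.cell _ _ τ hab ha hb)
          ⟨τ, evalLabel ih hR'⟩ (H.contraction.shape_cell _ _ τ hab ha hb).symm) :=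
        (hQ.symm.trans hshape.symm).trans (congrArg (H.shape.map (n + 1)) hgen)
      have hT := hQ'.trans (H.shape_comp _ _ _)
      refine Eq.trans ?_ ((H.comp_congr hgen rfl _ hQ').trans (H.assoc _ _ _ _ _)).symm
      rw [comp_gen hS]
      refine H.contractComp_eq hab ha hb
        (H.compPieces ⟨τ, evalLabel ih hR'⟩ Q hT).label fun k p => ?_
      refine (congrArg (eval H) (comp_cast_shape (ih k p).shape.symm _)).trans ?_
      refine (ih k p).comp (H.piece ⟨τ, evalLabel ih hR'⟩ Q hT p) _ _ fun m q => ?_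
      refine (hL m _).trans (congrArg (Q.label.map m) ?_)
      exact (Pos.emb_congr _ hS (fun k p => (ih k p).shape) _ hQ p q).symm

/-- The morphism of globular sets given by the values of formal composites. -/
noncomputable def I.evalHom (H : CGOp.{v}) : GlobularSet.Hom I.{u}.gset H.gset where
  map _ := fun x : { x : RawCell.{u} _ // x.WF } => x.1.eval H
  map_src := fun x : { x : RawCell.{u} _ // x.WF } => ((x.2.evalSpec H).src _ rfl).symm
  map_tgt := fun x : { x : RawCell.{u} _ // x.WF } => ((x.2.evalSpec H).tgt _ rfl).symm

theorem I.evalHom_map_shape (H : CGOp.{v}) {n : ℕ} (x : I.{u}.gset.cell n) :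
    H.shape.map n ((I.evalHom H).map n x) = I.{u}.shape.map n x :=
  (x.property.evalSpec H).shape

/-- The morphism from `I` to a globular operad with contraction. -/
noncomputable def I.desc (H : CGOp.{v}) : CGOp.Hom I.{u} H where
  toGSetHom := I.evalHom H
  map_shape := I.evalHom_map_shape H
  map_ids _ := rfl
  map_comp x P h := (x.property.evalSpec H).comp (P.map (I.evalHom H)) h.symm _ fun _ _ => rfl
  map_contraction x y τ h hx hy := by
    have hxy := (I.evalHom H).map_parallel h
    have ha := (I.evalHom_map_shape H x).trans hx
    have hb := (I.evalHom_map_shape H y).trans hy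
    refine (H.contractComp_eq hxy ha hb (H.idPasting τ).label fun _ _ => rfl).trans ?_
    refine Eq.trans ?_ (H.comp_id _)
    exact H.comp_congr rfl
      (congrArg H.idPasting (H.contraction.shape_cell _ _ τ hxy ha hb).symm) _ _

/-- A composite with a generator of `I` is the composite of the canonical contraction cell with the
pasting diagram of the labels. -/
theorem I.gen_eq_comp {n : ℕ} {x y : RawCell.{u} n} {τ : Pd (n + 1)}
    {R : ∀ k : ℕ, Pos τ k → RawCell.{u} k} (hx : x.WF) (hy : y.WF)
    (h : I.{u}.gset.Parallel ⟨x, hx⟩ ⟨y, hy⟩) (hxτ : x.shape = τ.bdry) (hyτ : y.shape = τ.bdry)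
    (M : GlobularSet.Hom τ.pos I.{u}.gset) (hM : ∀ k p, (M.map k p).1 = R k p)
    (hg : (RawCell.gen x y τ R).WF) :
    (⟨.gen x y τ R, hg⟩ : I.{u}.gset.cell (n + 1)) =
      I.{u}.comp (I.{u}.contraction.cell ⟨x, hx⟩ ⟨y, hy⟩ τ h hxτ hyτ) ⟨τ, M⟩
        (I.{u}.contraction.shape_cell _ _ τ h hxτ hyτ).symm := by
  have hS : IsShape fun k (_ : Pos τ k) => (RawCell.id.{u} k).shape := isShape_simple τ
  have e : (RawCell.gen x y τ fun k _ => .id k).shape = τ := Pd.subst_one τ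
  refine Subtype.ext (Eq.trans ?_ (RawCell.comp_gen hS e _).symm)
  refine congrArg (RawCell.gen x y τ) ?_
  funext k p
  refine (hM k p).symm.trans ?_
  exact congrArg (fun q => (M.map k q).1)
    (Pos.emb_one (isShape_simple τ) (Pd.subst_one τ) p).symm

theorem I.map_eq_eval {H : CGOp.{v}} (f : CGOp.Hom I.{u} H) {n : ℕ} {x : RawCell.{u} n}
    (hx : x.WF) : f.map n ⟨x, hx⟩ = x.eval H := by
  induction hx with
  | id n => exact f.map_ids n
  | @gen n x y τ R hx hy hxy hxτ hyτ hR hR' ihx ihy ih =>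
    have h : I.{u}.gset.Parallel ⟨x, hx⟩ ⟨y, hy⟩ := by
      cases n with
      | zero => trivial
      | succ n => exact ⟨Subtype.ext hxy.1, Subtype.ext hxy.2⟩
    let M : GlobularSet.Hom τ.pos I.{u}.gset :=
      ⟨fun k p => ⟨R k p, hR k p⟩, fun p => Subtype.ext (hR' _ p).1,
        fun p => Subtype.ext (hR' _ p).2⟩
    have hab := (hx.evalSpec H).parallel (hy.evalSpec H) hxy
    have ha := (hx.evalSpec H).shape.trans hxτ
    have hb := (hy.evalSpec H).shape.trans hyτ
    refine (congrArg (f.map (n + 1))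
      (I.gen_eq_comp hx hy h hxτ hyτ M (fun _ _ => rfl) _)).trans ?_
    refine (f.map_comp _ _ _).trans ?_
    refine Eq.trans ?_ (H.contractComp_eq hab ha hb (M.comp f.toGSetHom)
      fun k p => (ih k p).symm).symm
    refine H.comp_congr ?_ rfl _ _
    refine (f.map_contraction _ _ _ _ _ _).trans ?_
    exact H.contraction.cell_congr ihx ihy τ _ _ _ _ _ _

end Globular

theorem mainTheorem4 :
    Nonempty (CategoryTheory.Limits.IsInitial (Globular.I.{u} : Globular.CGOp.{u})) := by
  refine ⟨CategoryTheory.Limits.IsInitial.ofUniqueHom (fun H => Globular.I.desc H) fun H f => ?_⟩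
  refine Globular.CGOp.Hom.ext ?_
  funext n x
  exact Globular.I.map_eq_eval f x.property
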